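/- Let $SG_3(n)$ be the three-dimensional Sierpinski gasket graph at stage $n \ge 0$: $SG_3(0)$ is the complete graph on the four corners of a tetrahedron, and $SG_3(n+1)$ is the juxtaposition of four copies of $SG_3(n)$, indexed by the corners $1,\dots,4$, where for $i\neq j$ the $j$-th outmost vertex of copy $i$ is identified with the $i$-th outmost vertex of copy $j$; the $i$-th outmost vertex of $SG_3(n+1)$ is the $i$-th outmost vertex of copy $i$. A spanning forest of a graph is an acyclic subgraph with the same vertex set, and $v(SG_3(n))$ denotes the number of vertices. Let $f_3(n)$ be the number of all spanning forests of $SG_3(n)$, and let $t_3(n)$, $g_3(n)$, $h_3(n)$, $p_3(n)$, $q_3(n)$ be the numbers of those spanning forests for which the partition of the four outmost vertices into trees is a prescribed partition with block sizes, respectively, $4$; $1+3$; $2+2$; $2+1+1$; $1+1+1+1$. (i) These numbers do not depend on which of the outmost vertices are chosen to form the blocks. (ii) For every $n \ge 0$, writing $f,t,g,h,p,q$ for $f_3(n),t_3(n),g_3(n),h_3(n),p_3(n),q_3(n)$, the following recursion relations hold: $$f_3(n+1) = f^4 - 4f(t+2g+h+p)^3 - 3(t+2g+h+p)^4 + 12(t+2g+h+p)^2(t+g)^2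 - 6(t+g)^4,$$ $$\begin{aligned}t_3(n+1) ={}& 72t^2p(g+h) + 56t(g+h)^3 + 24t^2p^2 + 12tp(11g^2+12gh+h^2) + 12g^2(3g^2+8gh+6h^2) \\ & + 12tp^2(4g+h) + 48g^2p(g+h) + 4tp^3 + 12g^2p^2,\end{aligned}$$ $$\begin{aligned}g_3(n+1) ={}& 6t^2q(g+h) + 24t^2p^2 + 12tp(9g^2+16gh+7h^2) + 4g(5g^3+18g^2h+24gh^2+14h^3) + 6t^2pq \\ & + 6tp^2(21g+11h) + 3tq(5g^2+6gh+h^2) + 24gp(5g^2+9gh+4h^2) + 6tpq(3g+h) + 21tp^3 \\ & + 6gp^2(19g+13h) + 3gq(3g^2+4gh+h^2) + 3tp^2q + 6gpq(2g+h) + 25gp^3 + 3gp^2q,\end{aligned}$$ $$\begin{aligned}h_3(n+1) ={}& 2t^2p^2 + 12tp(g^2+4gh+3h^2) + 2(g^4+8g^3h+18g^2h^2+16gh^3+11h^4) + 8tp^2(2g+3h) \\ & + 8p(2g^3+9g^2h+9gh^2+2h^3) + 4tp^3 + 2p^2(10g^2+24gh+9h^2) + 8p^3(g+h) + p^4,\end{aligned}$$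 $$\begin{aligned}p_3(n+1) ={}& 6t^2pq + 120tp^2(g+h) + 14tq(g+h)^2 + 88p(g+h)^3 + 4tpq(13g+10h) + 78tp^3 \\ & + 6p^2(49g^2+78gh+29h^2) + 2q(11g^3+26g^2h+19gh^2+4h^3) + t^2q^2 + 2tq^2(2g+h) + 26tp^2q \\ & + 2pq(38g^2+50gh+15h^2) + 2p^3(115g+76h) + 2tpq^2 + q^2(4g^2+4gh+h^2) \\ & + 2p^2q(31g+18h) + 49p^4 + 2pq^2(2g+h) + 14p^3q + p^2q^2,\end{aligned}$$ $$\begin{aligned}q_3(n+1) ={}& 144tpq(g+h) + 208tp^3 + 720p^2(g+h)^2 + 56q(g+h)^3 + 24tq^2(g+h) + 252tp^2q \\ & + 24pq(25g^2+44gh+19h^2) + 104p^3(17g+15h) + 60tpq^2 + 24q^2(3g^2+5gh+2h^2) \\ & + 12p^2q(110g+89h) + 972p^4 + 4tq^3 + 12pq^2(22g+17h) + 776p^3q + 4q^3(4g+3h) \\ & + 210p^2q^2 + 24pq^3 + q^4.\end{aligned}$$ (iii) The limit $z_{SG_3} = \lim_{n\to\infty} \frac{\ln f_3(n)}{v(SG_3(n))}$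 exists, its decimal expansion begins $z_{SG_3} = 1.66680628117\ldots$, i.e. $1.66680628117 \le z_{SG_3} < 1.66680628118$, and for every $m \ge 0$ $$\frac{\ln q_3(m)}{2\cdot 4^m} < z_{SG_3} < \frac{\ln f_3(m)}{2\cdot 4^m}.$$ -/

import Mathlib

open Filter Topology

/-- A spanning forest of `G`: a subgraph on the same vertex set that contains no cycle. -/
def IsSpanningForest {V : Type*} (G H : SimpleGraph V) : Prop :=
  H ≤ G ∧ H.IsAcyclic

/-- The number of spanning forests of `G`. -/
noncomputable def numSpanningForests {V : Type*} (G : SimpleGraph V) : ℕ :=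
  {H : SimpleGraph V | IsSpanningForest G H}.ncard

namespace SG3

/-- The outmost vertices of the stage-`n` tetrahedron, in barycentric coordinates
scaled so that every elementary edge vector is `e_i - e_j`. -/
def corner (n : ℕ) (i : Fin 4) : Fin 4 → ℕ := Pi.single i (2 ^ n)

/-- The vertex set at stage `n`: stage `0` is the four corners of a tetrahedron, stage `n + 1`
consists of four translated copies of stage `n`, the `i`-th being moved by `corner n i`. Copies
`i ≠ j` meet exactly in the point `corner n i + corner n j`, which is corner `j` of copy `i` and
corner `i` of copy `j`. -/
def verts : ℕ → Finset (Fin 4 → ℕ)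
  | 0 => Finset.univ.image (corner 0)
  | n + 1 => Finset.univ.biUnion fun i => (verts n).image fun x => x + corner n i

/-- Adjacency at stage `n`: the complete graph at stage `0`; at stage `n + 1`, the edges are those
of the four translated copies of stage `n`. -/
def ambient : ℕ → SimpleGraph (Fin 4 → ℕ)
  | 0 => SimpleGraph.fromRel fun x y => x ∈ verts 0 ∧ y ∈ verts 0
  | n + 1 => ⨆ i : Fin 4, (ambient n).map (addRightEmbedding (corner n i))

/-- The three-dimensional Sierpinski gasket at stage `n`, as a graph on its vertex set. -/
def gasket (n : ℕ) : SimpleGraph (verts n) :=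
  (ambient n).induce (verts n : Set (Fin 4 → ℕ))

theorem corner_mem_verts (n : ℕ) (i : Fin 4) : corner n i ∈ verts n := by
  induction n with
  | zero => simp [verts]
  | succ n ih =>
    simp only [verts, Finset.mem_biUnion, Finset.mem_univ, true_and, Finset.mem_image]
    refine ⟨i, corner n i, ih, ?_⟩
    rw [corner, corner, ← Pi.single_add, pow_succ, mul_two]

/-- The `i`-th outmost vertex of the stage-`n` gasket. -/
def outmost (n : ℕ) (i : Fin 4) : verts n := ⟨corner n i, corner_mem_verts n i⟩

/-- The number of spanning forests of the stage-`n` gasket in which two outmost vertices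
`i`, `j` belong to the same tree exactly when they carry the same label `c i = c j`. -/
noncomputable def classCount (n : ℕ) (c : Fin 4 → ℕ) : ℕ :=
  {H : SimpleGraph (verts n) | IsSpanningForest (gasket n) H ∧
    ∀ i j : Fin 4, H.Reachable (outmost n i) (outmost n j) ↔ c i = c j}.ncard

/-- The number of all spanning forests. -/
noncomputable def f (n : ℕ) : ℕ := numSpanningForests (gasket n)

/-- Spanning forests with the four outmost vertices in one tree. -/
noncomputable def t (n : ℕ) : ℕ := classCount n ![0, 0, 0, 0]

/-- Spanning forests with one given outmost vertex in one tree and the other three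
together in another tree. -/
noncomputable def g (n : ℕ) : ℕ := classCount n ![0, 1, 1, 1]

/-- Spanning forests with two given outmost vertices in one tree and the other two
together in another tree. -/
noncomputable def h (n : ℕ) : ℕ := classCount n ![0, 0, 1, 1]

/-- Spanning forests with two given outmost vertices in one tree and the other two in
two further trees. -/
noncomputable def p (n : ℕ) : ℕ := classCount n ![0, 0, 1, 2]

/-- Spanning forests with the four outmost vertices in four different trees. -/
noncomputable def q (n : ℕ) : ℕ := classCount n ![0, 1, 2, 3]

end SG3

/-! A subgraph of stage `n + 1` is a free choice of one subgraph in each of the four copies, since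
copies share no edges, and it can only be a forest if all four pieces are. Distinct copies meet only
in corners. Hence whether the union is acyclic, and how it connects the new outmost vertices,
depends on each piece only through the partition which that piece induces on its own four corners
(`isAcyclic_sup_congr`, `Gluing.glue`). Each piece may therefore be replaced by a star forest on its
corners, and gluing becomes a finite computation with partitions of ten points.

Permuting coordinates is an automorphism (`classCount_comp_perm`), so the number of pieces with a
given partition depends only on its block sizes. Each class count at stage `n + 1` is thus a fixed
form of degree four in `t, g, h, p, q`: the sum over those of the `15 ^ 4` choices of partitions
which close no cycle and induce the prescribed partition (`Gluing.ncard_extensions`,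
`classCount_succ`).

These forms are identified by one evaluation each. Their coefficients add up to at most `15 ^ 4 < 2
^ 16`, so at suitable powers of `2 ^ 16` the coefficients are the digits of the value
(`total_copies_eq`), and the kernel compares two numbers (`kronecker_copies`). The recursion for `f`
is then a polynomial identity, by `f_eq`.

For the limit, `q n ^ 4 < q (n + 1)` and `f (n + 1) < f n ^ 4` make `lower` increase and `upper`
decrease. The number of vertices is `2 * 4 ^ n + 2`, so the limit is the infimum of `upper`. Its
digits come from exact values of `q 7` and `f 5` compared with powers of rational bounds for
exponentials. -/

namespace SimpleGraph

/-! ### Acyclicity and reachability under unions and embeddings -/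

variable {V : Type*}

theorem reachable_sup_edge {G : SimpleGraph V} {u v a b : V} :
    (G ⊔ edge u v).Reachable a b ↔
      G.Reachable a b ∨ (G.Reachable a u ∧ G.Reachable v b) ∨
        (G.Reachable a v ∧ G.Reachable u b) := by
  constructor
  · rw [reachable_iff_reflTransGen]
    intro h
    induction h with
    | refl => exact Or.inl (Reachable.refl _)
    | @tail c d _ hcd ih =>
      rw [sup_adj, edge_adj] at hcd
      rcases hcd with hcd | ⟨⟨rfl, rfl⟩ | ⟨rfl, rfl⟩, -⟩
      · have hr := hcd.reachable
        rcases ih with ih | ⟨h1, h2⟩ | ⟨h1, h2⟩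
        · exact Or.inl (ih.trans hr)
        · exact Or.inr (Or.inl ⟨h1, h2.trans hr⟩)
        · exact Or.inr (Or.inr ⟨h1, h2.trans hr⟩)
      · rcases ih with ih | ⟨h1, h2⟩ | ⟨h1, h2⟩
        · exact Or.inr (Or.inl ⟨ih, Reachable.refl _⟩)
        · exact Or.inr (Or.inl ⟨h1, Reachable.refl _⟩)
        · exact Or.inl h1
      · rcases ih with ih | ⟨h1, h2⟩ | ⟨h1, h2⟩
        · exact Or.inr (Or.inr ⟨ih, Reachable.refl _⟩)
        · exact Or.inl h1
        · exact Or.inr (Or.inr ⟨h1, Reachable.refl _⟩)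
  · have hle : G ≤ G ⊔ edge u v := le_sup_left
    have huv : (G ⊔ edge u v).Reachable u v := by
      by_cases h : u = v
      · subst h; exact Reachable.refl _
      · exact Adj.reachable (by simp [edge_adj, h])
    rintro (h | ⟨h1, h2⟩ | ⟨h1, h2⟩)
    · exact h.mono hle
    · exact (h1.mono hle).trans (huv.trans (h2.mono hle))
    · exact (h1.mono hle).trans (huv.symm.trans (h2.mono hle))

theorem isAcyclic_sup_edge_iff {G : SimpleGraph V} {u v : V} (hne : u ≠ v)
    (hadj : ¬G.Adj u v) :
    (G ⊔ edge u v).IsAcyclic ↔ G.IsAcyclic ∧ ¬G.Reachable u v := by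
  rw [isAcyclic_sup_fromEdgeSet_iff]
  tauto

theorem fromEdgeSet_insert (s : Set (Sym2 V)) (u v : V) :
    fromEdgeSet (insert s(u, v) s) = fromEdgeSet s ⊔ edge u v := by
  ext a b
  simp only [fromEdgeSet_adj, sup_adj, edge, Set.mem_insert_iff, Set.mem_singleton_iff]
  tauto

/-- Whether the union with `K` is acyclic, and which vertices it connects, depends on an acyclic
graph only through the connections it makes between the vertices that `K` uses. -/
theorem isAcyclic_sup_congr {H H' K : SimpleGraph V} {T : Set V} (hfin : K.edgeSet.Finite)
    (hr : ∀ a ∈ T, ∀ b ∈ T, (H.Reachable a b ↔ H'.Reachable a b))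
    (hH : H.IsAcyclic) (hH' : H'.IsAcyclic)
    (hK : ∀ a b, K.Adj a b → a ∈ T ∧ ¬H.Adj a b ∧ ¬H'.Adj a b) :
    ((H ⊔ K).IsAcyclic ↔ (H' ⊔ K).IsAcyclic) ∧
      ∀ a ∈ T, ∀ b ∈ T, ((H ⊔ K).Reachable a b ↔ (H' ⊔ K).Reachable a b) := by
  -- The edges of `K` are added one at a time. Each has both ends in `T`, so both the acyclicity
  -- test and the new connections within `T` involve only connections within `T`, on which the two
  -- sides agree by induction.
  suffices key : ∀ s : Set (Sym2 V), s.Finite → s ⊆ K.edgeSet →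
      ((H ⊔ fromEdgeSet s).IsAcyclic ↔ (H' ⊔ fromEdgeSet s).IsAcyclic) ∧
      ∀ a ∈ T, ∀ b ∈ T,
        ((H ⊔ fromEdgeSet s).Reachable a b ↔ (H' ⊔ fromEdgeSet s).Reachable a b) by
    simpa using key K.edgeSet hfin subset_rfl
  intro s hs
  induction s, hs using Set.Finite.induction_on with
  | empty => intro _; simpa using ⟨⟨fun _ => hH', fun _ => hH⟩, hr⟩
  | @insert e s hes hs ih =>
    intro hsub
    obtain ⟨ih1, ih2⟩ := ih ((Set.subset_insert _ _).trans hsub)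
    induction e with
    | h u v =>
      have huv : K.Adj u v := hsub (Set.mem_insert _ _)
      have hu := (hK u v huv).1
      have hv := (hK v u huv.symm).1
      rw [fromEdgeSet_insert, ← sup_assoc, ← sup_assoc,
        isAcyclic_sup_edge_iff huv.ne (by simp [(hK u v huv).2.1, hes]),
        isAcyclic_sup_edge_iff huv.ne (by simp [(hK u v huv).2.2, hes]), ih1, ih2 u hu v hv]
      refine ⟨Iff.rfl, fun a ha b hb => ?_⟩
      rw [reachable_sup_edge, reachable_sup_edge, ih2 a ha b hb, ih2 a ha u hu, ih2 v hv b hb,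
        ih2 a ha v hv, ih2 u hu b hb]

theorem Reachable.eq_of_forall_not_adj {G : SimpleGraph V} {a b : V} (h : G.Reachable a b)
    (ha : ∀ c, ¬G.Adj a c) : a = b := by
  obtain ⟨p⟩ := h
  cases p with
  | nil => rfl
  | cons hadj _ => exact (ha _ hadj).elim

theorem reachable_map_iff {W : Type*} (ψ : W ↪ V) (G : SimpleGraph W) (a b : W) :
    (G.map ψ).Reachable (ψ a) (ψ b) ↔ G.Reachable a b := by
  constructor
  · intro h
    -- A walk in the mapped graph that starts in the image of `ψ` never leaves it.
    suffices key : ∀ x, (G.map ψ).Reachable (ψ a) x → ∃ c, ψ c = x ∧ G.Reachable a c by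
      obtain ⟨c, hc, hac⟩ := key _ h
      rwa [ψ.injective hc] at hac
    intro x hx
    rw [reachable_iff_reflTransGen] at hx
    induction hx with
    | refl => exact ⟨a, rfl, Reachable.refl _⟩
    | tail _ hadj ih =>
      obtain ⟨c, rfl, hc⟩ := ih
      obtain ⟨c', d, hcd, h1, rfl⟩ := (map_adj ψ G _ _).1 hadj
      rw [ψ.injective h1] at hcd
      exact ⟨d, rfl, hc.trans hcd.reachable⟩
  · exact fun h => h.map (Embedding.map ψ G).toHom

/-- Acyclicity means that every edge is a bridge, which is a statement about reachability alone, and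
reachability is transported by `reachable_map_iff`. -/
theorem isAcyclic_map_iff {W : Type*} (ψ : W ↪ V) (G : SimpleGraph W) :
    (G.map ψ).IsAcyclic ↔ G.IsAcyclic := by
  refine ⟨IsAcyclic.of_map ψ, fun h => ?_⟩
  rw [isAcyclic_iff_forall_adj_isBridge] at h ⊢
  intro x y hxy
  obtain ⟨u, v, huv, rfl, rfl⟩ := (map_adj ψ G _ _).1 hxy
  have := h huv
  rw [isBridge_iff] at this ⊢
  intro hr
  apply this
  rw [← reachable_map_iff ψ]
  refine hr.mono ?_
  intro a b hab
  rw [deleteEdges_adj, map_adj] at hab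
  obtain ⟨⟨c, d, hcd, rfl, rfl⟩, hne⟩ := hab
  rw [map_adj]
  refine ⟨c, d, ?_, rfl, rfl⟩
  rw [deleteEdges_adj]
  refine ⟨hcd, fun h => hne ?_⟩
  simp only [Set.mem_singleton_iff, Sym2.eq_iff] at h ⊢
  rcases h with ⟨rfl, rfl⟩ | ⟨rfl, rfl⟩ <;> simp

/-- The subgraphs of a mapped graph are the images of the subgraphs. -/
theorem le_map_iff {W : Type*} (ψ : W ↪ V) (G : SimpleGraph W) (H : SimpleGraph V) :
    H ≤ G.map ψ ↔ ∃ K ≤ G, K.map ψ = H := by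
  constructor
  · intro h
    refine ⟨H.comap ψ, ?_, ?_⟩
    · intro a b hab
      obtain ⟨c, d, hcd, h1, h2⟩ := (map_adj ψ G _ _).1 (h hab)
      rwa [← ψ.injective h1, ← ψ.injective h2]
    · ext a b
      rw [map_adj]
      constructor
      · rintro ⟨c, d, hcd, rfl, rfl⟩
        exact hcd
      · intro hab
        obtain ⟨c, d, hcd, rfl, rfl⟩ := (map_adj ψ G _ _).1 (h hab)
        exact ⟨c, d, hab, rfl, rfl⟩
  · rintro ⟨K, hK, rfl⟩
    exact map_monotone ψ hK

end SimpleGraph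

/-! ### Partitions encoded as natural numbers -/

namespace SG3

open SimpleGraph

/-! A partition of ten points is stored as a number whose base `16` digits label the points. In the
states `12816` and `654820258320`, each of four, respectively ten, points is labelled by its own index. -/

/-- The label of point `i` in the state `s`. -/
def dig (s i : ℕ) : ℕ := Nat.mod (Nat.div s (Nat.pow 16 i)) 16

/-- The first `n` labels of `s`, with the label `b` replaced by `a`. -/
def relabel (s a b : ℕ) : ℕ → ℕ
  | 0 => 0
  | n + 1 => Nat.add (relabel s a b n)
      (Nat.mul (Nat.pow 16 n) (bif Nat.beq (dig s n) b then a else dig s n))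

/-- The state after joining the points `u` and `v` by an edge, plus one; zero if this edge
closes a cycle. -/
def join (s u v : ℕ) : ℕ :=
  bif Nat.beq (dig s u) (dig s v) then 0 else
    Nat.succ (bif Nat.ble (dig s u) (dig s v) then relabel s (dig s u) (dig s v) 10
      else relabel s (dig s v) (dig s u) 10)

/-- The state after adding a list of edges, plus one; zero if a cycle is closed. -/
def joinAll : List (ℕ × ℕ) → ℕ → ℕ
  | [], s => Nat.succ s
  | e :: es, s =>
    match join s e.1 e.2 with
    | 0 => 0
    | t + 1 => joinAll es t

theorem cond_beq {α : Type*} (a b : ℕ) (x y : α) :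
    (bif Nat.beq a b then x else y) = if a = b then x else y := by
  cases hb : Nat.beq a b with
  | true => rw [cond_true, if_pos (Nat.eq_of_beq_eq_true hb)]
  | false => rw [cond_false, if_neg (Nat.ne_of_beq_eq_false hb)]

theorem cond_ble {α : Type*} (a b : ℕ) (x y : α) :
    (bif Nat.ble a b then x else y) = if a ≤ b then x else y := by
  cases hb : Nat.ble a b with
  | true => rw [cond_true, if_pos (Nat.le_of_ble_eq_true hb)]
  | false => rw [cond_false, if_neg (Nat.not_le_of_not_ble_eq_true (by simp [hb]))]

theorem dig_def (s i : ℕ) : dig s i = s / 16 ^ i % 16 := rfl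

theorem dig_lt (s i : ℕ) : dig s i < 16 := Nat.mod_lt _ (by norm_num)

theorem dig_mod {s i m : ℕ} (h : i < m) : dig (s % 16 ^ m) i = dig s i := by
  obtain ⟨k, rfl⟩ := Nat.exists_eq_add_of_lt h
  rw [dig_def, dig_def, show i + k + 1 = i + (k + 1) by ring, pow_add, Nat.mod_mul_right_div_self,
    pow_succ', Nat.mod_mul_right_mod]

theorem relabel_succ (s a b n : ℕ) : relabel s a b (n + 1) =
    relabel s a b n + 16 ^ n * (if dig s n = b then a else dig s n) := by
  rw [relabel, cond_beq]
  rfl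

theorem relabel_lt {s a b : ℕ} (ha : a < 16) (n : ℕ) : relabel s a b n < 16 ^ n := by
  induction n with
  | zero => simp [relabel]
  | succ n ih =>
    rw [relabel_succ, pow_succ]
    have : (if dig s n = b then a else dig s n) ≤ 15 := by
      have := dig_lt s n
      split_ifs <;> omega
    nlinarith [pow_pos (show 0 < 16 by norm_num) n]

theorem dig_relabel {s a b n i : ℕ} (ha : a < 16) (hi : i < n) :
    dig (relabel s a b n) i = if dig s i = b then a else dig s i := by
  induction n with
  | zero => omega
  | succ n ih =>
    rcases Nat.lt_succ_iff_lt_or_eq.1 hi with h | rfl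
    · rw [← ih h, ← dig_mod h, relabel_succ, Nat.add_mul_mod_self_left, dig_mod h]
    · rw [relabel_succ, dig_def, Nat.add_mul_div_left _ _ (by positivity),
        Nat.div_eq_of_lt (relabel_lt ha i), zero_add, Nat.mod_eq_of_lt]
      have := dig_lt s i
      split_ifs <;> omega

variable {V : Type*}

/-- The first `m` labels of `s` tell which of the points `φ 0, …, φ (m - 1)` are connected. -/
def Represents (K : SimpleGraph V) (φ : ℕ → V) (m s : ℕ) : Prop :=
  ∀ a < m, ∀ b < m, (K.Reachable (φ a) (φ b) ↔ dig s a = dig s b)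

theorem join_eq_zero_iff {s u v : ℕ} : join s u v = 0 ↔ dig s u = dig s v := by
  rw [join, cond_beq]
  split_ifs with h <;> simp [h]

/-- The right-hand side has the shape of `reachable_sup_edge`: merging two labels does to a
partition what adding an edge does to connectivity. The bound `10` is the number of digits that
`join` rewrites. -/
theorem dig_eq_dig_of_join {s t u v a b : ℕ} (h : join s u v = t + 1) (ha : a < 10)
    (hb : b < 10) :
    dig t a = dig t b ↔ dig s a = dig s b ∨ (dig s a = dig s u ∧ dig s v = dig s b) ∨
        (dig s a = dig s v ∧ dig s u = dig s b) := by
  have hne : dig s u ≠ dig s v := fun h' => by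
    rw [join_eq_zero_iff.2 h'] at h
    omega
  rw [join, cond_beq, if_neg hne, cond_ble, Nat.succ_inj] at h
  subst h
  split_ifs <;>
  · rw [dig_relabel (dig_lt _ _) ha, dig_relabel (dig_lt _ _) hb]
    split_ifs <;> grind

theorem Represents.join {K : SimpleGraph V} {φ : ℕ → V} {m s t u v : ℕ}
    (h : Represents K φ m s) (hm : m ≤ 10) (hu : u < m) (hv : v < m)
    (hj : join s u v = t + 1) : Represents (K ⊔ edge (φ u) (φ v)) φ m t := by
  intro a ha b hb
  rw [reachable_sup_edge, h a ha b hb, h a ha u hu, h v hv b hb, h a ha v hv, h u hu b hb,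
    dig_eq_dig_of_join hj (by omega) (by omega)]

/-- The graph with the edges in a list of pairs of indices. -/
def listGraph (φ : ℕ → V) : List (ℕ × ℕ) → SimpleGraph V
  | [] => ⊥
  | e :: es => edge (φ e.1) (φ e.2) ⊔ listGraph φ es

theorem listGraph_adj_iff {φ : ℕ → V} {E : List (ℕ × ℕ)} {a b : V} :
    (listGraph φ E).Adj a b ↔ a ≠ b ∧ ∃ e ∈ E, s(a, b) = s(φ e.1, φ e.2) := by
  induction E with
  | nil => simp [listGraph]
  | cons e es ih =>
    simp only [listGraph, sup_adj, adj_edge, ih, List.mem_cons, exists_eq_or_imp]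
    rw [eq_comm (a := s(a, b)) (b := s(φ e.1, φ e.2))]
    tauto

theorem listGraph_adj {φ : ℕ → V} {E : List (ℕ × ℕ)} {a b : V} (h : (listGraph φ E).Adj a b) :
    ∃ e ∈ E, s(a, b) = s(φ e.1, φ e.2) :=
  (listGraph_adj_iff.1 h).2

theorem listGraph_map (φ : ℕ → V) (f : ℕ → ℕ) (E : List (ℕ × ℕ)) :
    listGraph φ (E.map (Prod.map f f)) = listGraph (φ ∘ f) E := by
  induction E with
  | nil => rfl
  | cons e es ih => simp [listGraph, ih]

/-- A new edge closes a cycle exactly when its ends already carry the same label. Edges are required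
to be distinct, and absent from `K`, because repeating an edge leaves the graph acyclic while `join`
would report a cycle. -/
theorem joinAll_spec {φ : ℕ → V} {m : ℕ} (hm : m ≤ 10) (E : List (ℕ × ℕ)) (K : SimpleGraph V)
    (s : ℕ) (hK : K.IsAcyclic) (h : Represents K φ m s)
    (hE : ∀ e ∈ E, e.1 < m ∧ e.2 < m ∧ φ e.1 ≠ φ e.2 ∧ ¬K.Adj (φ e.1) (φ e.2))
    (hp : E.Pairwise fun e e' => s(φ e.1, φ e.2) ≠ s(φ e'.1, φ e'.2)) :
    ((K ⊔ listGraph φ E).IsAcyclic ↔ joinAll E s ≠ 0) ∧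
      ∀ t, joinAll E s = t + 1 → Represents (K ⊔ listGraph φ E) φ m t := by
  induction E generalizing K s with
  | nil =>
    simp only [listGraph, joinAll, sup_bot_eq, hK, ne_eq, Nat.succ_ne_zero,
      not_false_iff, true_and]
    intro t ht
    rwa [← Nat.succ_inj.1 ht]
  | cons e es ih =>
    obtain ⟨h1, h2, h3, h4⟩ := hE e (by simp)
    have hacy := isAcyclic_sup_edge_iff h3 h4
    rw [h _ h1 _ h2, ← join_eq_zero_iff] at hacy
    rw [listGraph, ← sup_assoc, joinAll]
    rcases hj : join s e.1 e.2 with _ | t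
    · simp only [ne_eq, not_true, iff_false]
      refine ⟨fun hc => ?_, by simp⟩
      exact (hacy.1 (hc.anti le_sup_left)).2 hj
    · refine ih _ t (hacy.2 ⟨hK, by omega⟩) (h.join hm h1 h2 hj) ?_ (List.pairwise_cons.1 hp).2
      intro e' he'
      obtain ⟨h1', h2', h3', h4'⟩ := hE e' (by simp [he'])
      refine ⟨h1', h2', h3', ?_⟩
      rw [sup_adj, adj_edge]
      rintro (hc | hc)
      · exact h4' hc
      · exact (List.pairwise_cons.1 hp).1 e' he' hc.1

end SG3

/-! ### The fifteen partitions of four points -/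

namespace SG3

open SimpleGraph

/-- The partitions of four points: each point is labelled by the least point in its block, and the
first component tells the block sizes. -/
def patterns : List (Fin 5 × List ℕ) :=
  [(0, [0, 0, 0, 0]),
   (1, [0, 1, 1, 1]), (1, [0, 1, 0, 0]), (1, [0, 0, 2, 0]), (1, [0, 0, 0, 3]),
   (2, [0, 0, 2, 2]), (2, [0, 1, 0, 1]), (2, [0, 1, 1, 0]),
   (3, [0, 0, 2, 3]), (3, [0, 1, 0, 3]), (3, [0, 1, 2, 0]), (3, [0, 1, 1, 3]),
   (3, [0, 1, 2, 1]), (3, [0, 1, 2, 2]),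
   (4, [0, 1, 2, 3])]

/-- Edges joining every point to the least point in its block. -/
def starEdges (l : List ℕ) : List (ℕ × ℕ) :=
  ([1, 2, 3].filter fun j => !Nat.beq (l.getD j 0) j).map fun j => (l.getD j 0, j)

/-- The indices of the corners of the `i`-th copy among the ten points. -/
def cornerIndex (i : Fin 4) (a : ℕ) : ℕ :=
  (![[0, 9, 7, 4], [9, 1, 8, 5], [7, 8, 2, 6], [4, 5, 6, 3]] i).getD a 0

/-- The star edges, moved to the corners of the `i`-th copy. -/
def copyEdges (i : Fin 4) (l : List ℕ) : List (ℕ × ℕ) :=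
  (starEdges l).map (Prod.map (cornerIndex i) (cornerIndex i))

/-- The weighted number of ways to choose partitions for the copies in a list such that no cycle
arises. After each copy, only a given number of labels is kept. -/
def total {R : Type*} [CommSemiring R] (w : Fin 5 → R) (G : ℕ → R) :
    List (Fin 4 × ℕ) → ℕ → R
  | [], s => G s
  | c :: cs, s => (patterns.map fun x =>
      match joinAll (copyEdges c.1 x.2) s with
      | 0 => 0
      | t + 1 => w x.1 * total w G cs (t % 16 ^ c.2)).sum

/-- Every partition is realised by a forest on the four points alone, the union of a star on each
block; this forest stands in for an arbitrary one in `Gluing.glue`. -/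
theorem starEdges_spec : ∀ x ∈ patterns,
    (∀ e ∈ starEdges x.2, e.1 < 4 ∧ e.2 < 4 ∧ e.1 ≠ e.2) ∧
    ((starEdges x.2).Pairwise fun e e' => s(e.1, e.2) ≠ s(e'.1, e'.2)) ∧
    joinAll (starEdges x.2) 12816 ≠ 0 ∧
    ∀ a < 4, ∀ b < 4, (dig (joinAll (starEdges x.2) 12816 - 1) a =
      dig (joinAll (starEdges x.2) 12816 - 1) b ↔ x.2.getD a 0 = x.2.getD b 0) := by
  decide +kernel

theorem patterns_unique : ∀ x ∈ patterns, ∀ y ∈ patterns,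
    (∀ a < 4, ∀ b < 4, (x.2.getD a 0 = x.2.getD b 0 ↔ y.2.getD a 0 = y.2.getD b 0)) → x = y := by
  decide +kernel

-- A relation on four points is given by six Booleans. The twelve conditions are transitivity for
-- each of the four triples, in its three forms, so that only finitely many cases have to be
-- checked.
set_option synthInstance.maxHeartbeats 400000 in
set_option synthInstance.maxSize 2000 in
theorem exists_pattern_bool : ∀ r01 r02 r12 r03 r13 r23 : Bool,
    (r01 && r02 && !r12) = false ∧ (r01 && r12 && !r02) = false ∧ (r02 && r12 && !r01) = false ∧
    (r01 && r03 && !r13) = false ∧ (r01 && r13 && !r03) = false ∧ (r03 && r13 && !r01) = false ∧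
    (r02 && r03 && !r23) = false ∧ (r02 && r23 && !r03) = false ∧ (r03 && r23 && !r02) = false ∧
    (r12 && r13 && !r23) = false ∧ (r12 && r23 && !r13) = false ∧ (r13 && r23 && !r12) = false →
    ∃ x ∈ patterns, (r01 = true ↔ x.2.getD 0 0 = x.2.getD 1 0) ∧ (r02 = true ↔ x.2.getD 0 0 = x.2.getD 2 0) ∧
      (r12 = true ↔ x.2.getD 1 0 = x.2.getD 2 0) ∧ (r03 = true ↔ x.2.getD 0 0 = x.2.getD 3 0) ∧
      (r13 = true ↔ x.2.getD 1 0 = x.2.getD 3 0) ∧ (r23 = true ↔ x.2.getD 2 0 = x.2.getD 3 0) := by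
  decide +kernel

theorem exists_pattern {r : ℕ → ℕ → Prop} (hr : Equivalence r) :
    ∃ x ∈ patterns, ∀ a < 4, ∀ b < 4, (r a b ↔ x.2.getD a 0 = x.2.getD b 0) := by
  classical
  suffices h : ∃ x ∈ patterns, ∀ b < 4, ∀ a < b, (r a b ↔ x.2.getD a 0 = x.2.getD b 0) by
    obtain ⟨x, hx, h⟩ := h
    refine ⟨x, hx, fun a ha b hb => ?_⟩
    rcases lt_trichotomy a b with hab | rfl | hab
    · exact h b hb a hab
    · simp [hr.refl]
    · rw [← eq_comm, ← h a ha b hab]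
      exact ⟨hr.symm, hr.symm⟩
  have key : ∀ P : ℕ → ℕ → Prop, (∀ b < 4, ∀ a < b, P a b) ↔
      P 0 1 ∧ P 0 2 ∧ P 1 2 ∧ P 0 3 ∧ P 1 3 ∧ P 2 3 := by
    intro P
    constructor
    · intro h
      exact ⟨h 1 (by omega) 0 (by omega), h 2 (by omega) 0 (by omega), h 2 (by omega) 1 (by omega),
        h 3 (by omega) 0 (by omega), h 3 (by omega) 1 (by omega), h 3 (by omega) 2 (by omega)⟩
    · rintro ⟨h1, h2, h3, h4, h5, h6⟩ b hb a hab
      interval_cases b <;> interval_cases a <;> assumption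
  simp only [key]
  have h := exists_pattern_bool (decide (r 0 1)) (decide (r 0 2)) (decide (r 1 2))
    (decide (r 0 3)) (decide (r 1 3)) (decide (r 2 3))
  simp only [decide_eq_true_eq] at h
  refine h ⟨?_, ?_, ?_, ?_, ?_, ?_, ?_, ?_, ?_, ?_, ?_, ?_⟩ <;>
    (simp only [Bool.eq_false_iff, ne_eq, Bool.and_eq_true, decide_eq_true_eq, Bool.not_eq_true']
     rintro ⟨⟨h1, h2⟩, h3⟩
     apply h3)
  · exact hr.trans (hr.symm h1) h2
  · exact hr.trans h1 h2
  · exact hr.trans h1 (hr.symm h2)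
  · exact hr.trans (hr.symm h1) h2
  · exact hr.trans h1 h2
  · exact hr.trans h1 (hr.symm h2)
  · exact hr.trans (hr.symm h1) h2
  · exact hr.trans h1 h2
  · exact hr.trans h1 (hr.symm h2)
  · exact hr.trans (hr.symm h1) h2
  · exact hr.trans h1 h2
  · exact hr.trans h1 (hr.symm h2)
end SG3

/-! ### Gluing a forest onto the copies already treated -/

namespace SG3

open SimpleGraph

theorem cornerIndex_spec : ∀ i : Fin 4, ∀ a < 4, cornerIndex i a < 10 ∧
    ∀ b < 4, cornerIndex i a = cornerIndex i b → a = b := by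
  decide +kernel

variable {V : Type*}

/-- Four graphs `C i` on vertex sets `S i` which pairwise share at most one point, and
ten points such that any shared point of `S i` is one of the four of them listed in
`cornerIndex i`. -/
structure Gluing (φ : ℕ → V) (C : Fin 4 → SimpleGraph V) (S : Fin 4 → Set V) : Prop where
  finite : ∀ i, (C i).edgeSet.Finite
  mem : ∀ i a b, (C i).Adj a b → a ∈ S i
  inj : ∀ a < 10, ∀ b < 10, φ a = φ b → a = b
  point_mem : ∀ i, ∀ a < 4, φ (cornerIndex i a) ∈ S i
  point : ∀ i, ∀ k < 10, φ k ∈ S i → ∃ a < 4, k = cornerIndex i a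
  inter : ∀ i j, i ≠ j → (S i ∩ S j).Subsingleton
  corner : ∀ i j, i ≠ j → ∀ x ∈ S i, x ∈ S j → ∃ a < 4, x = φ (cornerIndex i a)

/-- The partition of the points with indices `k 0, …, k 3` by `H` is the one labelled by `l`. -/
def HasPattern (H : SimpleGraph V) (φ : ℕ → V) (k : ℕ → ℕ) (l : List ℕ) : Prop :=
  ∀ a < 4, ∀ b < 4, (H.Reachable (φ (k a)) (φ (k b)) ↔ l.getD a 0 = l.getD b 0)

theorem represents_bot {m s : ℕ} {γ : ℕ → V} (hs : ∀ a < m, dig s a = a)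
    (hγ : ∀ a < m, ∀ b < m, γ a = γ b → a = b) : Represents (⊥ : SimpleGraph V) γ m s := by
  intro a ha b hb
  rw [reachable_bot, hs a ha, hs b hb]
  exact ⟨hγ a ha b hb, fun h => h ▸ rfl⟩

theorem pairwise_edge_ne {m : ℕ} {γ : ℕ → V} (hγ : ∀ a < m, ∀ b < m, γ a = γ b → a = b)
    {E : List (ℕ × ℕ)} (hE : ∀ e ∈ E, e.1 < m ∧ e.2 < m)
    (hp : E.Pairwise fun e e' => s(e.1, e.2) ≠ s(e'.1, e'.2)) :
    E.Pairwise fun e e' => s(γ e.1, γ e.2) ≠ s(γ e'.1, γ e'.2) := by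
  refine hp.imp_of_mem fun {e e'} he he' hne h => hne ?_
  obtain ⟨h1, h2⟩ := hE _ he
  obtain ⟨h3, h4⟩ := hE _ he'
  rw [Sym2.eq_iff] at h ⊢
  rcases h with ⟨ha, hb⟩ | ⟨ha, hb⟩
  · exact Or.inl ⟨hγ _ h1 _ h3 ha, hγ _ h2 _ h4 hb⟩
  · exact Or.inr ⟨hγ _ h1 _ h4 ha, hγ _ h2 _ h3 hb⟩

theorem starEdges_pairwise {γ : ℕ → V} (hγ : ∀ a < 4, ∀ b < 4, γ a = γ b → a = b)
    {x : Fin 5 × List ℕ} (hx : x ∈ patterns) :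
    (starEdges x.2).Pairwise fun e e' => s(γ e.1, γ e.2) ≠ s(γ e'.1, γ e'.2) := by
  obtain ⟨h1, h2, -, -⟩ := starEdges_spec x hx
  exact pairwise_edge_ne hγ (fun e he => ⟨(h1 e he).1, (h1 e he).2.1⟩) h2

theorem hasPattern_starEdges {γ : ℕ → V} (hγ : ∀ a < 4, ∀ b < 4, γ a = γ b → a = b)
    {x : Fin 5 × List ℕ} (hx : x ∈ patterns) :
    (listGraph γ (starEdges x.2)).IsAcyclic ∧
      HasPattern (listGraph γ (starEdges x.2)) γ id x.2 := by
  obtain ⟨h1, -, h3, h4⟩ := starEdges_spec x hx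
  obtain ⟨h5, h6⟩ := joinAll_spec (m := 4) (by norm_num) (starEdges x.2) ⊥ 12816 isAcyclic_bot
    (represents_bot (by decide) hγ) (fun e he => ⟨(h1 e he).1, (h1 e he).2.1, fun h => (h1 e he).2.2
      (hγ _ (h1 e he).1 _ (h1 e he).2.1 h), by simp⟩) (starEdges_pairwise hγ hx)
  rw [bot_sup_eq] at h5 h6
  refine ⟨h5.2 h3, fun a ha b hb => ?_⟩
  rw [← h4 a ha b hb]
  exact h6 _ (by omega) a ha b hb

namespace Gluing

variable {φ : ℕ → V} {C : Fin 4 → SimpleGraph V} {S : Fin 4 → Set V}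

theorem corner_inj (hg : Gluing φ C S) (i : Fin 4) :
    ∀ a < 4, ∀ b < 4, φ (cornerIndex i a) = φ (cornerIndex i b) → a = b :=
  fun a ha b hb h => (cornerIndex_spec i a ha).2 b hb
    (hg.inj _ (cornerIndex_spec i a ha).1 _ (cornerIndex_spec i b hb).1 h)

/-- Adding a forest in a further copy to a forest `K` changes the state as prescribed by its
pattern. -/
theorem glue (hg : Gluing φ C S) {i : Fin 4} {K H : SimpleGraph V} {m s : ℕ}
    {x : Fin 5 × List ℕ} (hx : x ∈ patterns) (hm : m ≤ 10) (hi : ∀ a < 4, cornerIndex i a < m)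
    (hKf : K.edgeSet.Finite) (hKC : ∀ a b, K.Adj a b → ∃ j ≠ i, (C j).Adj a b)
    (hK : K.IsAcyclic) (hs : Represents K φ m s) (hHC : H ≤ C i) (hH : H.IsAcyclic)
    (hHx : HasPattern H φ (cornerIndex i) x.2) :
    ((K ⊔ H).IsAcyclic ↔ joinAll (copyEdges i x.2) s ≠ 0) ∧
      ∀ t, joinAll (copyEdges i x.2) s = t + 1 → Represents (K ⊔ H) φ m t := by
  have hinj := hg.corner_inj i
  have hlist : listGraph φ (copyEdges i x.2) =
      listGraph (φ ∘ cornerIndex i) (starEdges x.2) := listGraph_map _ _ _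
  obtain ⟨hst, -, -, -⟩ := starEdges_spec x hx
  -- `L` is the star forest on the corners of copy `i` with the same partition as `H`; the aim is to
  -- replace `H` by `L`, for which `joinAll_spec` applies.
  obtain ⟨hL, hLx⟩ := hasPattern_starEdges (γ := φ ∘ cornerIndex i) hinj hx
  rw [← hlist] at hL hLx
  set L := listGraph φ (copyEdges i x.2) with hLdef
  have hLS : ∀ a b, L.Adj a b → a ∈ S i := by
    intro a b hab
    rw [hlist] at hab
    obtain ⟨e, he, h⟩ := listGraph_adj hab
    rw [Sym2.eq_iff] at h
    rcases h with ⟨rfl, -⟩ | ⟨rfl, -⟩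
    · exact hg.point_mem i _ (hst e he).1
    · exact hg.point_mem i _ (hst e he).2.1
  have hKS : ∀ a b, K.Adj a b → ¬(a ∈ S i ∧ b ∈ S i) := by
    rintro a b hab ⟨ha, hb⟩
    obtain ⟨j, hj, hab'⟩ := hKC a b hab
    exact hab.ne (hg.inter j i hj ⟨hg.mem _ _ _ hab', ha⟩ ⟨hg.mem _ _ _ hab'.symm, hb⟩)
  -- `T` omits only the interior of copy `i`. It contains all ends of edges of `K`, since a vertex
  -- common to two copies is a corner, and all the numbered points. On `T`, `H` and `L` agree:
  -- points outside `S i` are isolated in both, and on corners both have partition `x.2`.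
  have hcongr := isAcyclic_sup_congr (H := H) (H' := L) (K := K)
    (T := {y | y ∉ S i ∨ ∃ a < 4, y = φ (cornerIndex i a)}) hKf ?_ hH hL ?_
  · obtain ⟨hc1, hc2⟩ := hcongr
    have hspec := joinAll_spec hm (copyEdges i x.2) K s hK hs ?_ ?_
    · rw [← hLdef, sup_comm K L, ← hc1] at hspec
      rw [sup_comm K H]
      refine ⟨hspec.1, fun t ht a ha b hb => ?_⟩
      have hT : ∀ k < m, φ k ∈ {y | y ∉ S i ∨ ∃ a < 4, y = φ (cornerIndex i a)} := by
        intro k hk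
        by_cases h : φ k ∈ S i
        · obtain ⟨a, ha, rfl⟩ := hg.point i k (by omega) h
          exact Or.inr ⟨a, ha, rfl⟩
        · exact Or.inl h
      rw [hc2 _ (hT a ha) _ (hT b hb)]
      exact hspec.2 t ht a ha b hb
    · intro e he
      obtain ⟨e', he', rfl⟩ := List.mem_map.1 he
      obtain ⟨h1, h2, h3⟩ := hst e' he'
      exact ⟨hi _ h1, hi _ h2, fun h => h3 (hinj _ h1 _ h2 h),
        fun h => hKS _ _ h ⟨hg.point_mem i _ h1, hg.point_mem i _ h2⟩⟩
    · rw [copyEdges, List.pairwise_map]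
      exact starEdges_pairwise (γ := φ ∘ cornerIndex i) hinj hx
  · have hiso : ∀ (a b : V) (P : SimpleGraph V), (∀ a b, P.Adj a b → a ∈ S i) → a ∉ S i →
        (P.Reachable a b ↔ a = b) := fun a b P hP ha =>
      ⟨fun h => h.eq_of_forall_not_adj fun c hc => ha (hP _ _ hc), fun h => h ▸ Reachable.refl _⟩
    have hHS : ∀ a b, H.Adj a b → a ∈ S i := fun a b h => hg.mem i a b (hHC h)
    rintro a (ha | ⟨k, hk, rfl⟩) b hb
    · rw [hiso a b H hHS ha, hiso a b L hLS ha]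
    · rcases hb with hb | ⟨k', hk', rfl⟩
      · rw [reachable_comm, hiso b _ H hHS hb, reachable_comm, hiso b _ L hLS hb]
      · rw [hHx k hk k' hk']
        exact (hLx k hk k' hk').symm
  · intro a b hab
    obtain ⟨j, hj, hab'⟩ := hKC a b hab
    refine ⟨?_, fun h => hKS a b hab ⟨hg.mem i _ _ (hHC h), hg.mem i _ _ (hHC h.symm)⟩,
      fun h => hKS a b hab ⟨hLS _ _ h, hLS _ _ h.symm⟩⟩
    by_cases h : a ∈ S i
    · exact Or.inr (hg.corner i j hj.symm a h (hg.mem _ _ _ hab'))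
    · exact Or.inl h

end Gluing

end SG3

/-! ### Counting forests copy by copy -/

namespace SimpleGraph

theorem finite_setOf_le {V : Type*} {G : SimpleGraph V} (h : G.edgeSet.Finite) :
    {H : SimpleGraph V | H ≤ G}.Finite := by
  refine Set.Finite.of_finite_image (f := edgeSet) (h.finite_subsets.subset ?_)
    edgeSet_injective.injOn
  rintro _ ⟨H, hH, rfl⟩
  exact edgeSet_subset_edgeSet.2 hH

end SimpleGraph

theorem Set.ncard_eq_sum_fiber {α β : Type*} {A : Set α} (hA : A.Finite) (B : Finset β)
    (f : α → β) (h : ∀ a ∈ A, f a ∈ B) : A.ncard = ∑ b ∈ B, {a ∈ A | f a = b}.ncard := by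
  classical
  rw [Set.ncard_eq_toFinset_card A hA, Finset.card_eq_sum_card_fiberwise (f := f) (t := B)]
  · refine Finset.sum_congr rfl fun b _ => ?_
    rw [← Set.ncard_coe_finset]
    congr 1
    ext a
    simp
  · intro a ha
    simpa using h a (by simpa using ha)

namespace SG3

open SimpleGraph

variable {V : Type*}

/-- The union of the graphs listed. -/
def supList (C : Fin 4 → SimpleGraph V) : List (Fin 4 × ℕ) → SimpleGraph V
  | [] => ⊥
  | c :: cs => C c.1 ⊔ supList C cs

/-- Each copy is listed once, and its corners are among the points whose labels have been kept. -/
def Valid : ℕ → List (Fin 4 × ℕ) → Prop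
  | m, [] => 4 ≤ m
  | m, c :: cs =>
    (∀ a < 4, cornerIndex c.1 a < m) ∧ c.2 ≤ m ∧ (∀ d ∈ cs, d.1 ≠ c.1) ∧ Valid c.2 cs

open Classical in
/-- One if the corners are labelled as in `l`, and zero otherwise. -/
noncomputable def patternIndicator (l : List ℕ) (s : ℕ) : ℕ :=
  if ∀ a < 4, ∀ b < 4, (dig s a = dig s b ↔ l.getD a 0 = l.getD b 0) then 1 else 0

theorem supList_adj {C : Fin 4 → SimpleGraph V} {L : List (Fin 4 × ℕ)} {a b : V}
    (h : (supList C L).Adj a b) : ∃ c ∈ L, (C c.1).Adj a b := by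
  induction L with
  | nil => simp [supList] at h
  | cons c cs ih =>
    rcases h with h | h
    · exact ⟨c, by simp, h⟩
    · obtain ⟨d, hd, h'⟩ := ih h
      exact ⟨d, by simp [hd], h'⟩

theorem Represents.mod {K : SimpleGraph V} {φ : ℕ → V} {m m' s : ℕ} (h : Represents K φ m s)
    (hm : m' ≤ m) : Represents K φ m' (s % 16 ^ m') := by
  intro a ha b hb
  rw [dig_mod ha, dig_mod hb]
  exact h a (by omega) b (by omega)

variable {φ : ℕ → V} {C : Fin 4 → SimpleGraph V} {S : Fin 4 → Set V}

-- The forests are grouped by the partition of the corners that they induce. Each forest has exactly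
-- one pattern, by `exists_pattern` and `patterns_unique`, and the summand is constant on a group.
open Classical in
theorem sum_pattern {w : Fin 5 → ℕ} {i : Fin 4}
    (hw : ∀ x ∈ patterns,
      {H | H ≤ C i ∧ H.IsAcyclic ∧ HasPattern H φ (cornerIndex i) x.2}.ncard = w x.1)
    {F : Finset (SimpleGraph V)} (hF : ∀ H, H ∈ F ↔ H ≤ C i ∧ H.IsAcyclic)
    (u : SimpleGraph V → ℕ) (v : Fin 5 × List ℕ → ℕ)
    (huv : ∀ H ∈ F, ∀ x ∈ patterns, HasPattern H φ (cornerIndex i) x.2 → u H = v x) :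
    ∑ H ∈ F, u H = (patterns.map fun x => w x.1 * v x).sum := by
  have hex : ∀ H : SimpleGraph V, ∃ x ∈ patterns, HasPattern H φ (cornerIndex i) x.2 := fun H =>
    exists_pattern (r := fun a b => H.Reachable (φ (cornerIndex i a)) (φ (cornerIndex i b)))
      ⟨fun _ => Reachable.refl _, Reachable.symm, Reachable.trans⟩
  choose pat hpat hpat' using hex
  rw [← List.sum_toFinset _ (by decide +kernel : patterns.Nodup),
    ← Finset.sum_fiberwise_of_maps_to (g := pat) (t := patterns.toFinset)
      (fun H _ => by simpa using hpat H)]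
  refine Finset.sum_congr rfl fun x hx => ?_
  have hx' : x ∈ patterns := by simpa using hx
  rw [Finset.sum_congr rfl (g := fun _ => v x), Finset.sum_const, smul_eq_mul, ← hw x hx',
    ← Set.ncard_coe_finset]
  · congr 2
    ext H
    simp only [Finset.coe_filter, Set.mem_ofPred_eq, hF, and_assoc]
    refine and_congr_right fun _ => and_congr_right fun _ => ⟨fun h => h ▸ hpat' H, fun h => ?_⟩
    exact patterns_unique _ (hpat H) _ hx' fun a ha b hb =>
      (hpat' H a ha b hb).symm.trans (h a ha b hb)
  · intro H hH
    rw [Finset.mem_filter] at hH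
    exact huv H hH.1 x hx' (hH.2 ▸ hpat' H)

namespace Gluing

theorem disjoint_supList (hg : Gluing φ C S) {i : Fin 4} {L : List (Fin 4 × ℕ)}
    (hi : ∀ d ∈ L, d.1 ≠ i) : Disjoint (C i) (supList C L) := by
  rw [disjoint_left]
  intro a b hab hab'
  obtain ⟨c, hc, hc'⟩ := supList_adj hab'
  exact hab.ne (hg.inter i c.1 (hi c hc).symm ⟨hg.mem _ _ _ hab, hg.mem _ _ _ hc'⟩
    ⟨hg.mem _ _ _ hab.symm, hg.mem _ _ _ hc'.symm⟩)

theorem finite_supList (hg : Gluing φ C S) (L : List (Fin 4 × ℕ)) :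
    (supList C L).edgeSet.Finite := by
  induction L with
  | nil => simp [supList]
  | cons c cs ih =>
    rw [supList, edgeSet_sup]
    exact (hg.finite _).union ih

/-- The number of forests in a union of copies which extend a forest `K` to a forest with a given
pattern. -/
theorem ncard_extensions (hg : Gluing φ C S) {w : Fin 5 → ℕ}
    (hw : ∀ i, ∀ x ∈ patterns,
      {H | H ≤ C i ∧ H.IsAcyclic ∧ HasPattern H φ (cornerIndex i) x.2}.ncard = w x.1)
    (l : List ℕ) (L : List (Fin 4 × ℕ)) {K : SimpleGraph V} {m s : ℕ} (hm : m ≤ 10)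
    (hL : Valid m L) (hKf : K.edgeSet.Finite)
    (hKC : ∀ a b, K.Adj a b → ∃ j, (∀ d ∈ L, d.1 ≠ j) ∧ (C j).Adj a b)
    (hK : K.IsAcyclic) (hs : Represents K φ m s) :
    {H | H ≤ supList C L ∧ (K ⊔ H).IsAcyclic ∧ HasPattern (K ⊔ H) φ id l}.ncard =
      total w (patternIndicator l) L s := by
  classical
  induction L generalizing K m s with
  | nil =>
    rw [total, patternIndicator]
    have hiff : HasPattern K φ id l ↔
        ∀ a < 4, ∀ b < 4, (dig s a = dig s b ↔ l.getD a 0 = l.getD b 0) := by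
      refine forall₂_congr fun a ha => forall₂_congr fun b hb => ?_
      have h4 : 4 ≤ m := hL
      rw [id, id, hs a (by omega) b (by omega)]
    rw [← hiff]
    by_cases h : HasPattern K φ id l
    · rw [if_pos h, Set.ncard_eq_one]
      refine ⟨⊥, Set.eq_singleton_iff_unique_mem.2 ⟨⟨le_rfl, by simpa, by simpa⟩, ?_⟩⟩
      exact fun H hH => le_bot_iff.1 hH.1
    · rw [if_neg h, (Set.ncard_eq_zero _).2]
      · refine Set.eq_empty_of_forall_notMem fun H hH => h ?_
        obtain rfl := le_bot_iff.1 hH.1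
        simpa using hH.2.2
      · exact (finite_setOf_le (by simp [supList])).subset fun H hH => hH.1
  | cons c cs ih =>
    obtain ⟨hL1, hL2, hL3, hL4⟩ := hL
    have hdisj := hg.disjoint_supList hL3
    have hfinC := finite_setOf_le (hg.finite c.1)
    have hFfin : {H | H ≤ C c.1 ∧ H.IsAcyclic}.Finite := hfinC.subset fun H hH => hH.1
    -- The extensions are sorted by their part `H₁` in the first copy. For fixed `H₁` the rest is
    -- counted by induction with `K ⊔ H₁` in place of `K`, and this number depends only on the
    -- pattern of `H₁`.
    rw [Set.ncard_eq_sum_fiber (f := fun H => H ⊓ C c.1) (B := hFfin.toFinset)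
      ((finite_setOf_le (hg.finite_supList (c :: cs))).subset fun H hH => hH.1), total]
    · refine (sum_pattern (hw c.1) (by simp) _
        (fun x => match joinAll (copyEdges c.1 x.2) s with
          | 0 => 0
          | t + 1 => total w (patternIndicator l) cs (t % 16 ^ c.2)) ?_).trans
        (congrArg List.sum (List.map_congr_left fun x _ => ?_))
      swap
      · cases joinAll (copyEdges c.1 x.2) s <;> simp
      intro H₁ hH₁ x hx hH₁x
      rw [Set.Finite.mem_toFinset] at hH₁
      obtain ⟨hle, hacy⟩ := hH₁
      obtain ⟨hg1, hg2⟩ := hg.glue hx hm hL1 hKf (fun a b hab => by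
        obtain ⟨j, hj, h⟩ := hKC a b hab
        exact ⟨j, fun h' => hj c (by simp) h'.symm, h⟩) hK hs hle hacy hH₁x
      -- Copies are edge-disjoint, so an extension with part `H₁` in the first copy is `H₁ ⊔ H₂` for
      -- a unique `H₂` in the remaining ones.
      have himg : {H | H ∈ {H | H ≤ supList C (c :: cs) ∧ (K ⊔ H).IsAcyclic ∧
            HasPattern (K ⊔ H) φ id l} ∧ H ⊓ C c.1 = H₁} =
          (fun H => H₁ ⊔ H) '' {H | H ≤ supList C cs ∧ (K ⊔ H₁ ⊔ H).IsAcyclic ∧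
            HasPattern (K ⊔ H₁ ⊔ H) φ id l} := by
        ext H
        constructor
        · rintro ⟨⟨h1, h2, h3⟩, rfl⟩
          have hH : H ⊓ C c.1 ⊔ H ⊓ supList C cs = H := by
            rw [← inf_sup_left]
            exact inf_eq_left.2 h1
          refine ⟨H ⊓ supList C cs, ⟨inf_le_right, ?_, ?_⟩, hH⟩
          · rwa [sup_assoc, hH]
          · rwa [sup_assoc, hH]
        · rintro ⟨H₂, ⟨h1, h2, h3⟩, rfl⟩
          rw [sup_assoc] at h2 h3
          refine ⟨⟨sup_le_sup hle h1, h2, h3⟩, ?_⟩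
          rw [inf_sup_right, inf_eq_left.2 hle, (hdisj.mono_right h1).symm.eq_bot, sup_bot_eq]
      rw [himg, Set.InjOn.ncard_image]
      · rcases hj : joinAll (copyEdges c.1 x.2) s with _ | t
        · rw [Set.ncard_eq_zero ((finite_setOf_le (hg.finite_supList cs)).subset
            fun H hH => hH.1)]
          refine Set.eq_empty_of_forall_notMem fun H hH => ?_
          exact hg1.1 (hH.2.1.anti le_sup_left) hj
        · refine ih (by omega) hL4 ?_ ?_ (hg1.2 (by omega)) ((hg2 t hj).mod hL2)
          · rw [edgeSet_sup]
            exact hKf.union ((hg.finite c.1).subset (edgeSet_subset_edgeSet.2 hle))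
          · rintro a b (h | h)
            · obtain ⟨j, hj, h⟩ := hKC a b h
              exact ⟨j, fun d hd => hj d (by simp [hd]), h⟩
            · exact ⟨c.1, hL3, hle h⟩
      · intro H hH H' hH' heq
        have : ∀ X ∈ {H | H ≤ supList C cs ∧ (K ⊔ H₁ ⊔ H).IsAcyclic ∧
            HasPattern (K ⊔ H₁ ⊔ H) φ id l}, (H₁ ⊔ X) ⊓ supList C cs = X := fun X hX => by
          rw [inf_sup_right, (hdisj.mono_left hle).eq_bot, bot_sup_eq, inf_eq_left.2 hX.1]
        rw [← this H hH, ← this H' hH']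
        exact congrArg (· ⊓ supList C cs) heq
    · intro H hH
      rw [Set.Finite.mem_toFinset]
      exact ⟨inf_le_right, hH.2.1.anti (inf_le_left.trans le_sup_right)⟩

end Gluing

end SG3

/-! ### The gasket in coordinates -/

namespace SG3

open SimpleGraph

theorem corner_apply (n : ℕ) (i j : Fin 4) : corner n i j = 2 ^ n * if i = j then 1 else 0 := by
  rw [corner, Pi.single_apply]
  by_cases h : i = j
  · simp [h]
  · rw [if_neg h, if_neg (Ne.symm h), mul_zero]

theorem corner_add_corner (n : ℕ) (i : Fin 4) : corner n i + corner n i = corner (n + 1) i := by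
  rw [corner, corner, ← Pi.single_add, pow_succ, mul_two]

theorem mem_verts_succ {n : ℕ} {x : Fin 4 → ℕ} :
    x ∈ verts (n + 1) ↔ ∃ i, ∃ y ∈ verts n, y + corner n i = x := by
  simp [verts]

theorem mem_verts_zero {x : Fin 4 → ℕ} : x ∈ verts 0 ↔ ∃ i, corner 0 i = x := by
  simp [verts]

theorem sum_of_mem_verts {n : ℕ} {x : Fin 4 → ℕ} (hx : x ∈ verts n) : ∑ j, x j = 2 ^ n := by
  induction n generalizing x with
  | zero =>
    obtain ⟨i, rfl⟩ := mem_verts_zero.1 hx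
    simp [corner]
  | succ n ih =>
    obtain ⟨i, y, hy, rfl⟩ := mem_verts_succ.1 hx
    simp only [Pi.add_apply, Finset.sum_add_distrib, ih hy]
    simp [corner, pow_succ, mul_two]

theorem ambient_succ_adj {n : ℕ} {x y : Fin 4 → ℕ} :
    (ambient (n + 1)).Adj x y ↔
      ∃ i a b, (ambient n).Adj a b ∧ a + corner n i = x ∧ b + corner n i = y := by
  simp [ambient, iSup_adj, map_adj]

theorem ambient_zero_adj {x y : Fin 4 → ℕ} :
    (ambient 0).Adj x y ↔ x ≠ y ∧ x ∈ verts 0 ∧ y ∈ verts 0 := by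
  rw [ambient, fromRel_adj]
  tauto

theorem mem_verts_of_ambient_adj {n : ℕ} {x y : Fin 4 → ℕ} (h : (ambient n).Adj x y) :
    x ∈ verts n := by
  induction n generalizing x y with
  | zero => exact (ambient_zero_adj.1 h).2.1
  | succ n ih =>
    obtain ⟨i, a, b, hab, rfl, rfl⟩ := ambient_succ_adj.1 h
    exact mem_verts_succ.2 ⟨i, a, ih hab, rfl⟩

theorem gasket_map_subtype (n : ℕ) :
    (gasket n).map (Function.Embedding.subtype (· ∈ verts n)) = ambient n := by
  ext x y
  rw [map_adj]
  constructor
  · rintro ⟨a, b, hab, rfl, rfl⟩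
    exact hab
  · intro h
    exact ⟨⟨x, mem_verts_of_ambient_adj h⟩, ⟨y, mem_verts_of_ambient_adj h.symm⟩, h, rfl, rfl⟩

/-! ### Copies of the gasket in an ambient vertex type -/

theorem setOf_forest_map {V W : Type*} (ψ : W ↪ V) (G : SimpleGraph W)
    (P : SimpleGraph V → Prop) :
    {H | H ≤ G.map ψ ∧ H.IsAcyclic ∧ P H} =
      (fun H : SimpleGraph W => H.map ψ) '' {H | IsSpanningForest G H ∧ P (H.map ψ)} := by
  ext H
  constructor
  · rintro ⟨h1, h2, h3⟩
    obtain ⟨K, hK, rfl⟩ := (le_map_iff ψ G H).1 h1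
    exact ⟨K, ⟨⟨hK, (isAcyclic_map_iff ψ K).1 h2⟩, h3⟩, rfl⟩
  · rintro ⟨K, ⟨⟨h1, h2⟩, h3⟩, rfl⟩
    exact ⟨map_monotone ψ h1, (isAcyclic_map_iff ψ K).2 h2, h3⟩

theorem ncard_forest_map {V W : Type*} (ψ : W ↪ V) (G : SimpleGraph W)
    (P : SimpleGraph V → Prop) :
    {H | H ≤ G.map ψ ∧ H.IsAcyclic ∧ P H}.ncard =
      {H | IsSpanningForest G H ∧ P (H.map ψ)}.ncard := by
  rw [setOf_forest_map, Set.ncard_image_of_injective _ (map_injective ψ)]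

/-- Vertices outside the image of `ψ` are isolated and do not affect the count, so the copies and
their union can all be treated as graphs on one vertex type. -/
theorem classCount_eq_ncard {V : Type*} {n : ℕ} (ψ : verts n ↪ V) (c : Fin 4 → ℕ) :
    classCount n c = {H | H ≤ (gasket n).map ψ ∧ H.IsAcyclic ∧
      ∀ i j, H.Reachable (ψ (outmost n i)) (ψ (outmost n j)) ↔ c i = c j}.ncard := by
  rw [ncard_forest_map]
  simp only [reachable_map_iff]
  rfl

theorem classCount_congr {n : ℕ} {c c' : Fin 4 → ℕ} (h : ∀ i j, c i = c j ↔ c' i = c' j) :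
    classCount n c = classCount n c' := by
  simp only [classCount, h]

/-! ### Symmetry -/

/-- Permutation of the coordinates. -/
def permute (σ : Equiv.Perm (Fin 4)) : (Fin 4 → ℕ) ≃ (Fin 4 → ℕ) :=
  σ.arrowCongr (Equiv.refl ℕ)

theorem permute_corner (σ : Equiv.Perm (Fin 4)) (n : ℕ) (i : Fin 4) :
    permute σ (corner n i) = corner n (σ i) := by
  ext j
  simp only [permute, Equiv.arrowCongr_apply, Equiv.coe_refl, Function.comp_apply, id,
    corner_apply, Equiv.eq_symm_apply]

theorem permute_add (σ : Equiv.Perm (Fin 4)) (x y : Fin 4 → ℕ) :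
    permute σ (x + y) = permute σ x + permute σ y := rfl

theorem permute_mem_verts (σ : Equiv.Perm (Fin 4)) {n : ℕ} {x : Fin 4 → ℕ} (hx : x ∈ verts n) :
    permute σ x ∈ verts n := by
  induction n generalizing x with
  | zero =>
    obtain ⟨i, rfl⟩ := mem_verts_zero.1 hx
    exact mem_verts_zero.2 ⟨σ i, (permute_corner σ 0 i).symm⟩
  | succ n ih =>
    obtain ⟨i, y, hy, rfl⟩ := mem_verts_succ.1 hx
    exact mem_verts_succ.2 ⟨σ i, _, ih hy, by rw [permute_add, permute_corner]⟩

theorem ambient_adj_permute (σ : Equiv.Perm (Fin 4)) {n : ℕ} {x y : Fin 4 → ℕ}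
    (h : (ambient n).Adj x y) : (ambient n).Adj (permute σ x) (permute σ y) := by
  induction n generalizing x y with
  | zero =>
    rw [ambient_zero_adj] at h ⊢
    exact ⟨(permute σ).injective.ne h.1, permute_mem_verts σ h.2.1, permute_mem_verts σ h.2.2⟩
  | succ n ih =>
    obtain ⟨i, a, b, hab, rfl, rfl⟩ := ambient_succ_adj.1 h
    exact ambient_succ_adj.2 ⟨σ i, _, _, ih hab, by rw [permute_add, permute_corner],
      by rw [permute_add, permute_corner]⟩

theorem ambient_map_permute (σ : Equiv.Perm (Fin 4)) (n : ℕ) :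
    (ambient n).map (permute σ).toEmbedding = ambient n := by
  ext x y
  rw [map_adj]
  constructor
  · rintro ⟨a, b, hab, rfl, rfl⟩
    exact ambient_adj_permute σ hab
  · intro h
    refine ⟨permute σ.symm x, permute σ.symm y, ambient_adj_permute _ h, ?_, ?_⟩ <;>
    · ext j
      simp [permute]

/-- Permuting the coordinates maps the gasket to itself and moves outmost vertex `i` to `σ i`. The
count is taken once through the inclusion and once through the inclusion followed by this
permutation. -/
theorem classCount_comp_perm (n : ℕ) (c : Fin 4 → ℕ) (σ : Equiv.Perm (Fin 4)) :
    classCount n (c ∘ σ) = classCount n c := by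
  rw [classCount_eq_ncard ((Function.Embedding.subtype (· ∈ verts n)).trans
      (permute σ).toEmbedding), classCount_eq_ncard (Function.Embedding.subtype (· ∈ verts n)),
    Function.Embedding.coe_trans, ← SimpleGraph.map_map, gasket_map_subtype,
    ambient_map_permute]
  congr 1
  ext H
  refine and_congr_right fun _ => and_congr_right fun _ => ?_
  have hφ : ∀ i, (permute σ).toEmbedding
      ((Function.Embedding.subtype (· ∈ verts n)) (outmost n i)) =
        (Function.Embedding.subtype (· ∈ verts n)) (outmost n (σ i)) :=
    fun i => permute_corner σ n i
  simp only [Function.comp_apply, hφ]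
  constructor
  · intro h i j
    simpa using h (σ.symm i) (σ.symm j)
  · exact fun h i j => h _ _

/-! ### The four copies in the next stage -/

/-- The coordinates of the ten points which are corners of copies. -/
def pointPair (k : ℕ) : Fin 4 × Fin 4 :=
  [(0, 0), (1, 1), (2, 2), (3, 3), (0, 3), (1, 3), (2, 3), (0, 2), (1, 2), (0, 1)].getD k (0, 0)

/-- The ten points which are corners of copies of stage `n` in stage `n + 1`. -/
def point (n k : ℕ) : Fin 4 → ℕ := corner n (pointPair k).1 + corner n (pointPair k).2

/-- The `i`-th copy of stage `n` in stage `n + 1`. -/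
def copyEmbedding (n : ℕ) (i : Fin 4) : verts n ↪ (Fin 4 → ℕ) :=
  (Function.Embedding.subtype (· ∈ verts n)).trans (addRightEmbedding (corner n i))

theorem point_cornerIndex (n : ℕ) (i a : Fin 4) :
    point n (cornerIndex i a) = corner n a + corner n i := by
  have h : ∀ i a : Fin 4, pointPair (cornerIndex i a) = (i, a) ∨
      pointPair (cornerIndex i a) = (a, i) := by decide
  rcases h i a with h | h
  · rw [point, h, add_comm]
  · rw [point, h]

theorem copyEmbedding_outmost (n : ℕ) (i a : Fin 4) :
    copyEmbedding n i (outmost n a) = point n (cornerIndex i a) :=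
  (point_cornerIndex n i a).symm

theorem point_corner (n : ℕ) (a : Fin 4) : point n a = corner (n + 1) a := by
  have h : ∀ a : Fin 4, pointPair a = (a, a) := by decide
  rw [point, h, corner_add_corner]

theorem eq_of_mem_range_copyEmbedding {n : ℕ} {i j : Fin 4} (hij : i ≠ j) {x : Fin 4 → ℕ}
    (hi : x ∈ Set.range (copyEmbedding n i)) (hj : x ∈ Set.range (copyEmbedding n j)) :
    x = corner n j + corner n i := by
  obtain ⟨⟨y, hy⟩, rfl⟩ := hi
  obtain ⟨⟨z, hz⟩, hyz⟩ := hj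
  change z + corner n j = y + corner n i at hyz
  change y + corner n i = corner n j + corner n i
  congr 1
  -- Lying in copy `j` forces the `j`-th coordinate of `y` to be at least `2 ^ n`. As the
  -- coordinates of `y` sum to `2 ^ n`, nothing is left for the others.
  have hle : ∀ k ∈ Finset.univ, corner n j k ≤ y k := by
    intro k _
    have := congrFun hyz k
    simp only [Pi.add_apply] at this
    by_cases hk : j = k
    · subst hk
      rw [corner_apply n i, if_neg hij] at this
      omega
    · rw [corner_apply, if_neg hk]
      omega
  have hsum : ∑ k, corner n j k = ∑ k, y k := by
    rw [sum_of_mem_verts hy, sum_of_mem_verts (corner_mem_verts n j)]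
  exact funext fun k => ((Finset.sum_eq_sum_iff_of_le hle).1 hsum k (Finset.mem_univ k)).symm

theorem gluing (n : ℕ) : Gluing (point n) (fun i => (gasket n).map (copyEmbedding n i))
    (fun i => Set.range (copyEmbedding n i)) where
  finite i := by
    rw [edgeSet_map]
    exact (Set.toFinite _).image _
  mem i a b h := by
    obtain ⟨c, d, -, rfl, -⟩ := (map_adj _ _ _ _).1 h
    exact ⟨c, rfl⟩
  inj a ha b hb h := by
    have key : ∀ a < 10, ∀ b < 10,
        (∀ x : Fin 4, (if (pointPair a).1 = x then 1 else 0) + (if (pointPair a).2 = x then 1 else 0)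
          = (if (pointPair b).1 = x then 1 else 0) + (if (pointPair b).2 = x then 1 else 0)) →
        a = b := by decide +kernel
    refine key a ha b hb fun x => ?_
    have := congrFun h x
    simp only [point, Pi.add_apply, corner_apply, ← mul_add] at this
    exact Nat.eq_of_mul_eq_mul_left (by positivity) this
  point_mem i a ha := by
    rw [show a = ((⟨a, ha⟩ : Fin 4) : ℕ) from rfl, ← copyEmbedding_outmost]
    exact ⟨_, rfl⟩
  point i k hk h := by
    obtain ⟨⟨y, hy⟩, h⟩ := h
    -- Points of copy `i` have `i`-th coordinate at least `2 ^ n`, while that of `point n k`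
    -- vanishes if `i` does not occur in `pointPair k`.
    have key : ∀ i : Fin 4, ∀ k < 10, (pointPair k).1 = i ∨ (pointPair k).2 = i →
        ∃ a < 4, k = cornerIndex i a := by decide +kernel
    refine key i k hk ?_
    by_contra! hne
    have := congrFun h i
    change y i + corner n i i = corner n _ i + corner n _ i at this
    rw [corner_apply, corner_apply, corner_apply, if_pos rfl, if_neg hne.1, if_neg hne.2] at this
    have : 0 < 2 ^ n := by positivity
    omega
  inter i j hij x hx y hy := by
    rw [eq_of_mem_range_copyEmbedding hij hx.1 hx.2, eq_of_mem_range_copyEmbedding hij hy.1 hy.2]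
  corner i j hij x hx hx' :=
    ⟨j, j.2, by rw [point_cornerIndex, eq_of_mem_range_copyEmbedding hij hx hx']⟩

/-- The counts `t, g, h, p, q` indexed by the type of the partition. -/
noncomputable def count (n : ℕ) : Fin 5 → ℕ := ![t n, g n, h n, p n, q n]

/-- The labellings used to define `t, g, h, p, q`. -/
def standard : Fin 5 → Fin 4 → ℕ :=
  ![![0, 0, 0, 0], ![0, 1, 1, 1], ![0, 0, 1, 1], ![0, 0, 1, 2], ![0, 1, 2, 3]]

theorem count_eq (n : ℕ) (k : Fin 5) : count n k = classCount n (standard k) := by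
  fin_cases k <;> rfl

/-- With `classCount_comp_perm` this reduces the fifteen class counts to the five named ones. -/
theorem exists_perm_standard : ∀ x ∈ patterns, ∃ σ : Equiv.Perm (Fin 4), ∀ i j : Fin 4,
    (x.2.getD i 0 = x.2.getD j 0 ↔ standard x.1 (σ i) = standard x.1 (σ j)) := by
  decide +kernel

theorem classCount_pattern (n : ℕ) {x : Fin 5 × List ℕ} (hx : x ∈ patterns) :
    classCount n (fun i => x.2.getD i 0) = count n x.1 := by
  obtain ⟨σ, hσ⟩ := exists_perm_standard x hx
  rw [count_eq, ← classCount_comp_perm n (standard x.1) σ]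
  exact classCount_congr hσ

theorem hasPattern_iff {n : ℕ} {i : Fin 4} {l : List ℕ} {H : SimpleGraph (Fin 4 → ℕ)} :
    HasPattern H (point n) (cornerIndex i) l ↔
      ∀ a b : Fin 4, (H.Reachable (copyEmbedding n i (outmost n a))
        (copyEmbedding n i (outmost n b)) ↔ l.getD a 0 = l.getD b 0) := by
  simp only [copyEmbedding_outmost]
  exact ⟨fun h a b => h a a.2 b b.2, fun h a ha b hb => h ⟨a, ha⟩ ⟨b, hb⟩⟩

theorem ncard_pattern (n : ℕ) (i : Fin 4) {x : Fin 5 × List ℕ} (hx : x ∈ patterns) :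
    {H | H ≤ (gasket n).map (copyEmbedding n i) ∧ H.IsAcyclic ∧
      HasPattern H (point n) (cornerIndex i) x.2}.ncard = count n x.1 := by
  rw [← classCount_pattern n hx, classCount_eq_ncard (copyEmbedding n i)]
  simp only [hasPattern_iff]

/-- The coefficients are the numbers of partitions of each type. Copy `0` serves only as a place
where `sum_pattern` can be applied, with constant summand one. -/
theorem f_eq (n : ℕ) : f n = t n + 4 * g n + 3 * h n + 6 * p n + q n := by
  have hfin : {H | H ≤ (gasket n).map (copyEmbedding n 0) ∧ H.IsAcyclic}.Finite :=
    (finite_setOf_le ((gluing n).finite 0)).subset fun H hH => hH.1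
  have hsum := sum_pattern (C := fun i => (gasket n).map (copyEmbedding n i)) (φ := point n)
    (fun x hx => ncard_pattern n 0 hx) (F := hfin.toFinset) (by simp) (fun _ => 1) (fun _ => 1)
    (fun _ _ _ _ _ => rfl)
  rw [Finset.sum_const, smul_eq_mul, mul_one, ← Set.ncard_eq_toFinset_card _ hfin] at hsum
  have hf := ncard_forest_map (copyEmbedding n 0) (gasket n) fun _ => True
  simp only [and_true] at hf
  rw [hf] at hsum
  rw [f, numSpanningForests, hsum]
  simp [patterns, count]
  ring

/-- The copies, with the number of labels kept after adding each of them. -/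
def copies : List (Fin 4 × ℕ) := [(0, 10), (1, 9), (2, 7), (3, 4)]

theorem supList_copies (n : ℕ) :
    supList (fun i => (gasket n).map (copyEmbedding n i)) copies = ambient (n + 1) := by
  have h : ∀ i, (gasket n).map (copyEmbedding n i) =
      (ambient n).map (addRightEmbedding (corner n i)) := fun i => by
    rw [copyEmbedding, Function.Embedding.coe_trans, ← SimpleGraph.map_map, gasket_map_subtype]
  simp only [supList, copies, h, ambient, sup_bot_eq]
  apply le_antisymm
  · have hle := le_iSup fun i => (ambient n).map (addRightEmbedding (corner n i))
    exact sup_le (hle 0) (sup_le (hle 1) (sup_le (hle 2) (hle 3)))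
  · refine iSup_le fun i => ?_
    fin_cases i
    · exact le_sup_left
    · exact le_sup_left.trans le_sup_right
    · exact le_sup_left.trans (le_sup_right.trans le_sup_right)
    · exact le_sup_right.trans (le_sup_right.trans le_sup_right)

theorem classCount_succ (n : ℕ) (l : List ℕ) :
    classCount (n + 1) (fun i => l.getD i 0) =
      total (count n) (patternIndicator l) copies 654820258320 := by
  -- The points are numbered so that those finished first come last: `9` joins copies `0` and `1`,
  -- `7` and `8` join these to copy `2`, and `4`, `5`, `6` join copy `3` to the others. A label is
  -- dropped once both copies at its point have been added, which leaves `10`, `9`, `7`, `4` labels.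
  have hval : Valid 10 copies := by
    simp only [Valid, copies]
    decide
  rw [← (gluing n).ncard_extensions (fun i x hx => ncard_pattern n i hx) l copies le_rfl hval
    (by simp) (by simp) isAcyclic_bot
      (represents_bot (by decide) (gluing n).inj),
    classCount_eq_ncard (Function.Embedding.subtype (· ∈ verts (n + 1))), gasket_map_subtype,
    supList_copies]
  congr 1
  ext H
  simp only [bot_sup_eq, Set.mem_ofPred_eq]
  refine and_congr_right fun _ => and_congr_right fun _ => ?_
  have hφ : ∀ a : Fin 4, point n a =
      (Function.Embedding.subtype (· ∈ verts (n + 1))) (outmost (n + 1) a) := point_corner n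
  exact ⟨fun h a ha b hb => by
    have := h ⟨a, ha⟩ ⟨b, hb⟩
    rwa [← hφ, ← hφ] at this, fun h a b => by
    rw [← hφ, ← hφ]
    exact h a a.2 b b.2⟩

end SG3

/-! ### Reading off a polynomial from a single value -/

/-- A polynomial with natural coefficients less than `B` is determined by its value at `B`. -/
theorem Polynomial.eq_of_eval_eq_of_coeff_lt {B : ℕ} {P Q : Polynomial ℕ}
    (hP : ∀ n, P.coeff n < B) (hQ : ∀ n, Q.coeff n < B) (h : P.eval B = Q.eval B) : P = Q := by
  ext n
  induction n generalizing P Q with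
  | zero =>
    rw [← P.divX_mul_X_add, ← Q.divX_mul_X_add] at h
    simp only [eval_add, eval_mul, eval_X, eval_C] at h
    have := congrArg (· % B) h
    simpa [Nat.add_mod, Nat.mod_eq_of_lt (hP 0), Nat.mod_eq_of_lt (hQ 0)] using this
  | succ n ih =>
    rw [← coeff_divX, ← coeff_divX]
    refine ih (fun m => by simpa using hP (m + 1)) (fun m => by simpa using hQ (m + 1)) ?_
    rw [← P.divX_mul_X_add, ← Q.divX_mul_X_add] at h
    simp only [eval_add, eval_mul, eval_X, eval_C] at h
    have := congrArg (· / B) h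
    have hB : 0 < B := (Nat.zero_le _).trans_lt (hP 0)
    simpa [Nat.add_comm _ (coeff _ 0), Nat.add_mul_div_right _ _ hB, Nat.div_eq_of_lt (hP 0),
      Nat.div_eq_of_lt (hQ 0)] using this

/-- A list of fewer than `B` exponents is determined, up to order, by the sum of the corresponding
powers of `B`. -/
theorem List.perm_of_sum_pow_eq {B : ℕ} {l l' : List ℕ} (hl : l.length < B) (hl' : l'.length < B)
    (h : (l.map fun x => B ^ x).sum = (l'.map fun x => B ^ x).sum) : l.Perm l' := by
  -- In the polynomial with one monomial `X ^ x` for each entry `x`, coefficients are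
  -- multiplicities; these are bounded by the length, hence less than `B`.
  have hcoeff : ∀ (l : List ℕ) (n : ℕ),
      (l.map fun x => (Polynomial.X : Polynomial ℕ) ^ x).sum.coeff n = l.count n := by
    intro l n
    induction l with
    | nil => simp
    | cons a l ih =>
      rw [List.map_cons, List.sum_cons, Polynomial.coeff_add, ih, Polynomial.coeff_X_pow, add_comm]
      by_cases h : a = n
      · subst h
        simp
      · simp [h, Ne.symm h]
  have heval : ∀ l : List ℕ, (l.map fun x => (Polynomial.X : Polynomial ℕ) ^ x).sum.eval B =
      (l.map fun x => B ^ x).sum := by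
    intro l
    induction l with
    | nil => simp
    | cons a l ih => simp [ih]
  rw [List.perm_iff_count]
  intro n
  rw [← hcoeff, ← hcoeff]
  congr 1
  refine Polynomial.eq_of_eval_eq_of_coeff_lt (B := B) (fun n => ?_) (fun n => ?_) ?_
  · rw [hcoeff]
    exact List.count_le_length.trans_lt hl
  · rw [hcoeff]
    exact List.count_le_length.trans_lt hl'
  · rw [heval, heval, h]

namespace SG3

/-- The sequences of partition types, together with the resulting states, over which `total`
sums. -/
def words : List (Fin 4 × ℕ) → ℕ → List (List (Fin 5) × ℕ)
  | [], s => [([], s)]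
  | c :: cs, s => patterns.flatMap fun x =>
      match joinAll (copyEdges c.1 x.2) s with
      | 0 => []
      | t + 1 => (words cs (t % 16 ^ c.2)).map fun m => (x.1 :: m.1, m.2)

theorem total_eq_sum_words (w : Fin 5 → ℕ) (G : ℕ → ℕ) (L : List (Fin 4 × ℕ)) (s : ℕ) :
    total w G L s = ((words L s).map fun m => (m.1.map w).prod * G m.2).sum := by
  induction L generalizing s with
  | nil => simp [total, words]
  | cons c cs ih =>
    rw [total, words, List.map_flatMap, List.flatMap_def, List.sum_flatten, List.map_map]
    refine congrArg List.sum (List.map_congr_left fun x _ => ?_)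
    simp only [Function.comp_apply]
    rcases joinAll (copyEdges c.1 x.2) s with _ | t
    · simp
    · simp [ih, mul_assoc, List.sum_map_mul_left, Function.comp_def]

theorem length_of_mem_words {L : List (Fin 4 × ℕ)} {s : ℕ} {m : List (Fin 5) × ℕ}
    (hm : m ∈ words L s) : m.1.length = L.length := by
  induction L generalizing s m with
  | nil =>
    rw [words, List.mem_singleton] at hm
    simp [hm]
  | cons c cs ih =>
    rw [words, List.mem_flatMap] at hm
    obtain ⟨x, -, hx⟩ := hm
    rcases hj : joinAll (copyEdges c.1 x.2) s with _ | t
    · simp [hj] at hx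
    · rw [hj] at hx
      obtain ⟨m', hm', rfl⟩ := List.mem_map.1 hx
      simp [ih hm']

theorem length_words_le (L : List (Fin 4 × ℕ)) (s : ℕ) : (words L s).length ≤ 15 ^ L.length := by
  induction L generalizing s with
  | nil => simp [words]
  | cons c cs ih =>
    rw [words, List.length_flatMap, List.length_cons, pow_succ']
    have hle : ∀ y ∈ patterns.map fun x => (match joinAll (copyEdges c.1 x.2) s with
        | 0 => []
        | t + 1 => (words cs (t % 16 ^ c.2)).map fun m : List (Fin 5) × ℕ => (x.1 :: m.1, m.2)).length,
        y ≤ 15 ^ cs.length := by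
      intro y hy
      obtain ⟨x, -, rfl⟩ := List.mem_map.1 hy
      rcases joinAll (copyEdges c.1 x.2) s with _ | t
      · simp
      · simpa using ih _
    have := List.sum_le_card_nsmul _ _ hle
    simpa [patterns] using this

/-- Exponents separating the monomials of degree four. -/
def weight (k : Fin 5) : ℕ := ![0, 1, 5, 25, 125] k

/-- The monomial of degree four encoded by a sum of values of `weight`. -/
def monomial (w : Fin 5 → ℕ) (c : ℕ) : ℕ :=
  w 0 ^ (4 - (c % 5 + c / 5 % 5 + c / 25 % 5 + c / 125)) * w 1 ^ (c % 5) * w 2 ^ (c / 5 % 5) *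
    w 3 ^ (c / 25 % 5) * w 4 ^ (c / 125)

/-- The multiplicities of types `1` to `4` are the base `5` digits of the sum of weights, no digit
exceeding four. Type `0` has weight zero, and its multiplicity is what is missing from the total
degree `4`. -/
theorem prod_eq_monomial (w : Fin 5 → ℕ) {m : List (Fin 5)} (hm : m.length = 4) :
    (m.map w).prod = monomial w (m.map weight).sum := by
  have hprod := Finset.prod_list_map_count m w
  have hsum := Finset.sum_list_map_count m weight
  rw [Finset.prod_subset (Finset.subset_univ _)
    (fun x _ hx => by rw [List.count_eq_zero_of_not_mem (by simpa using hx), pow_zero])] at hprod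
  rw [Finset.sum_subset (Finset.subset_univ _)
    (fun x _ hx => by rw [List.count_eq_zero_of_not_mem (by simpa using hx), zero_smul])] at hsum
  have hlen := Finset.sum_list_map_count m (fun _ => 1)
  rw [Finset.sum_subset (Finset.subset_univ _)
    (fun x _ hx => by rw [List.count_eq_zero_of_not_mem (by simpa using hx), zero_smul])] at hlen
  simp only [Fin.sum_univ_five, Fin.prod_univ_five, smul_eq_mul, weight, List.map_const',
    List.sum_replicate, hm, mul_one] at hprod hsum hlen
  simp only [Matrix.cons_val] at hsum
  rw [hprod, hsum, monomial]
  generalize m.count 0 = a at *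
  generalize m.count 1 = b at *
  generalize m.count 2 = c at *
  generalize m.count 3 = d at *
  generalize m.count 4 = e at *
  have h1 : (a * 0 + b * 1 + c * 5 + d * 25 + e * 125) % 5 = b := by omega
  have h2 : (a * 0 + b * 1 + c * 5 + d * 25 + e * 125) / 5 % 5 = c := by omega
  have h3 : (a * 0 + b * 1 + c * 5 + d * 25 + e * 125) / 25 % 5 = d := by omega
  have h4 : (a * 0 + b * 1 + c * 5 + d * 25 + e * 125) / 125 = e := by omega
  simp only [mul_zero, mul_one, zero_add] at h1 h2 h3 h4 ⊢
  rw [h1, h2, h3, h4, show 4 - (b + c + d + e) = a by omega]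

/-- Whether the corners are labelled as in `l`. -/
def matchesPattern (l : List ℕ) (s : ℕ) : Bool :=
  [(0, 1), (0, 2), (0, 3), (1, 2), (1, 3), (2, 3)].all fun e =>
    !(Bool.xor (Nat.beq (dig s e.1) (dig s e.2)) (Nat.beq (l.getD e.1 0) (l.getD e.2 0)))

theorem matchesPattern_iff {l : List ℕ} {s : ℕ} : matchesPattern l s = true ↔
    ∀ a < 4, ∀ b < 4, (dig s a = dig s b ↔ l.getD a 0 = l.getD b 0) := by
  have hx : ∀ a b c d : ℕ, (!(Bool.xor (Nat.beq a b) (Nat.beq c d))) = true ↔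
      (a = b ↔ c = d) := by
    intro a b c d
    rw [← Nat.beq_eq, ← Nat.beq_eq]
    cases Nat.beq a b <;> cases Nat.beq c d <;> simp
  simp only [matchesPattern, List.all_cons, List.all_nil, Bool.and_eq_true, hx, and_true]
  constructor
  · rintro ⟨h1, h2, h3, h4, h5, h6⟩ a ha b hb
    interval_cases a <;> interval_cases b <;>
      first
      | exact ⟨fun _ => rfl, fun _ => rfl⟩
      | assumption
      | (rw [eq_comm, eq_comm (a := l.getD _ _)]; assumption)
  · intro h
    exact ⟨h 0 (by omega) 1 (by omega), h 0 (by omega) 2 (by omega), h 0 (by omega) 3 (by omega),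
      h 1 (by omega) 2 (by omega), h 1 (by omega) 3 (by omega), h 2 (by omega) 3 (by omega)⟩

theorem patternIndicator_eq (l : List ℕ) (s : ℕ) :
    patternIndicator l s = bif matchesPattern l s then 1 else 0 := by
  rw [patternIndicator]
  by_cases h : matchesPattern l s = true
  · rw [if_pos (matchesPattern_iff.1 h), h, cond_true]
  · rw [if_neg (fun h' => h (matchesPattern_iff.2 h')), Bool.eq_false_iff.2 h, cond_false]

/-- `total` for powers of `2 ^ 16` as weights, in a form suited for evaluation. The inner match
forces the evaluation of the state. -/
def kronecker (l : List ℕ) : List (Fin 4 × ℕ) → ℕ → ℕ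
  | [], s => bif matchesPattern l s then 1 else 0
  | c :: cs, s => patterns.foldr (fun x r => Nat.add (
      match joinAll (copyEdges c.1 x.2) s with
      | 0 => 0
      | t + 1 => Nat.shiftLeft (match Nat.mod t (Nat.pow 16 c.2) with
        | 0 => kronecker l cs 0
        | v + 1 => kronecker l cs (Nat.succ v)) (Nat.mul 16 (weight x.1))) r) 0

theorem kronecker_eq_total (l : List ℕ) (L : List (Fin 4 × ℕ)) (s : ℕ) :
    kronecker l L s = total (fun k => (2 ^ 16) ^ weight k) (patternIndicator l) L s := by
  induction L generalizing s with
  | nil => rw [kronecker, total, patternIndicator_eq]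
  | cons c cs ih =>
    rw [kronecker, total, List.sum_eq_foldr, List.foldr_map]
    congr 1
    funext x r
    change _ + r = _ + r
    congr 1
    rcases joinAll (copyEdges c.1 x.2) s with _ | t
    · rfl
    · have hv : ∀ v, (match v with
          | 0 => kronecker l cs 0
          | v + 1 => kronecker l cs (Nat.succ v)) = kronecker l cs v := by
        rintro (_ | v) <;> rfl
      simp only [hv]
      change kronecker l cs (t % 16 ^ c.2) <<< (16 * weight x.1) = _
      rw [ih, Nat.shiftLeft_eq, ← pow_mul, mul_comm]

/-- If the Kronecker substitution into a list of terms gives the value computed by `kronecker`,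
then `total` is the sum of these terms. -/
theorem total_copies_eq (l : List ℕ) (terms : List (ℕ × ℕ))
    (h : kronecker l copies 654820258320 = (terms.map fun a => a.1 * (2 ^ 16) ^ a.2).sum)
    (hlen : (terms.map Prod.fst).sum < 2 ^ 16) (w : Fin 5 → ℕ) :
    total w (patternIndicator l) copies 654820258320 =
      (terms.map fun a => a.1 * monomial w a.2).sum := by
  set W := (words copies 654820258320).filter fun m => matchesPattern l m.2 with hW
  have htotal : ∀ w : Fin 5 → ℕ, total w (patternIndicator l) copies 654820258320 =
      (W.map fun m => (m.1.map w).prod).sum := by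
    intro w
    rw [total_eq_sum_words, hW]
    induction words copies 654820258320 with
    | nil => simp
    | cons m ms ih =>
      rw [List.map_cons, List.sum_cons, ih, patternIndicator_eq, List.filter_cons]
      cases matchesPattern l m.2 <;> simp
  have hterms : ∀ F : ℕ → ℕ, ((terms.flatMap fun a => List.replicate a.1 a.2).map F).sum =
      (terms.map fun a => a.1 * F a.2).sum := by
    intro F
    clear h hlen
    induction terms with
    | nil => simp
    | cons a as ih => simp [ih]
  -- There are at most `15 ^ 4 = 50625 < 2 ^ 16` words, so in base `2 ^ 16` the multiplicities of
  -- the exponents do not carry, and the one numerical equality `h` determines them all.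
  have hperm : (W.map fun m => (m.1.map weight).sum).Perm
      (terms.flatMap fun a => List.replicate a.1 a.2) := by
    refine List.perm_of_sum_pow_eq (B := 2 ^ 16) ?_ ?_ ?_
    · rw [List.length_map]
      refine (List.length_filter_le _ _).trans_lt ((length_words_le _ _).trans_lt ?_)
      norm_num [copies]
    · simpa [List.length_flatMap, Function.comp_def] using hlen
    · rw [hterms, ← h, kronecker_eq_total, htotal, List.map_map]
      refine congrArg List.sum (List.map_congr_left fun m _ => ?_)
      rw [Function.comp_apply]
      induction m.1 with
      | nil => simp
      | cons k ks ih =>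
        rw [List.map_cons, List.map_cons, List.sum_cons, List.prod_cons, ← ih, pow_add]
  rw [htotal, ← hterms, ← (hperm.map _).sum_eq, List.map_map]
  refine congrArg List.sum (List.map_congr_left fun m hm => ?_)
  exact prod_eq_monomial w (length_of_mem_words (List.mem_of_mem_filter hm))

/-! ### The recursion relations -/

/-- The terms of the recursion for `t`: coefficients and encoded monomials. -/
def tTerms : List (ℕ × ℕ) :=
  [(56, 3), (36, 4), (168, 7), (96, 8), (168, 11), (72, 12), (56, 15), (72, 26), (132, 27),
   (48, 28), (72, 30), (144, 31), (48, 32), (12, 35), (24, 50), (48, 51), (12, 52), (12, 55),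
   (4, 75)]

/-- The terms of the recursion for `g`: coefficients and encoded monomials. -/
def gTerms : List (ℕ × ℕ) :=
  [(20, 4), (72, 8), (96, 12), (56, 16), (108, 27), (120, 28), (192, 31), (216, 32), (84, 35),
   (96, 36), (24, 50), (126, 51), (114, 52), (66, 55), (78, 56), (21, 75), (25, 76), (6, 126),
   (15, 127), (9, 128), (6, 130), (18, 131), (12, 132), (3, 135), (3, 136), (6, 150), (18, 151),
   (12, 152), (6, 155), (6, 156), (3, 175), (3, 176)]

/-- The terms of the recursion for `h`: coefficients and encoded monomials. -/
def hTerms : List (ℕ × ℕ) :=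
  [(2, 4), (16, 8), (36, 12), (32, 16), (22, 20), (12, 27), (16, 28), (48, 31), (72, 32),
   (36, 35), (72, 36), (16, 40), (2, 50), (16, 51), (20, 52), (24, 55), (48, 56), (18, 60),
   (4, 75), (8, 76), (8, 80), (1, 100)]

/-- The terms of the recursion for `p`: coefficients and encoded monomials. -/
def pTerms : List (ℕ × ℕ) :=
  [(88, 28), (264, 32), (264, 36), (88, 40), (120, 51), (294, 52), (120, 55), (468, 56),
   (174, 60), (78, 75), (230, 76), (152, 80), (49, 100), (14, 127), (22, 128), (28, 131),
   (52, 132), (14, 135), (38, 136), (8, 140), (6, 150), (52, 151), (76, 152), (40, 155),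
   (100, 156), (30, 160), (26, 175), (62, 176), (36, 180), (14, 200), (1, 250), (4, 251),
   (4, 252), (2, 255), (4, 256), (1, 260), (2, 275), (4, 276), (2, 280), (1, 300)]

/-- The terms of the recursion for `q`: coefficients and encoded monomials. -/
def qTerms : List (ℕ × ℕ) :=
  [(720, 52), (1440, 56), (720, 60), (208, 75), (1768, 76), (1560, 80), (972, 100), (56, 128),
   (168, 132), (168, 136), (56, 140), (144, 151), (600, 152), (144, 155), (1056, 156), (456, 160),
   (252, 175), (1320, 176), (1068, 180), (776, 200), (24, 251), (72, 252), (24, 255), (120, 256),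
   (48, 260), (60, 275), (264, 276), (204, 280), (210, 300), (4, 375), (16, 376), (12, 380),
   (24, 400), (1, 500)]

/-- The finite enumeration behind all five recursions. The second test bounds the sum of the claimed
coefficients, as `total_copies_eq` needs to exclude carries on that side too. -/
theorem kronecker_copies :
    [([0, 0, 0, 0], tTerms), ([0, 1, 1, 1], gTerms), ([0, 0, 2, 2], hTerms),
      ([0, 0, 2, 3], pTerms), ([0, 1, 2, 3], qTerms)].all (fun x =>
        Nat.beq (kronecker x.1 copies 654820258320)
          (x.2.foldr (fun a r => Nat.add (Nat.mul a.1 (Nat.pow 2 (Nat.mul 16 a.2))) r) 0) &&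
        Nat.blt (x.2.foldr (fun a r => Nat.add a.1 r) 0) 65536) = true := by
  decide +kernel

theorem classCount_succ_eq_sum {l : List ℕ} {terms : List (ℕ × ℕ)}
    (h : (l, terms) ∈ [([0, 0, 0, 0], tTerms), ([0, 1, 1, 1], gTerms), ([0, 0, 2, 2], hTerms),
      ([0, 0, 2, 3], pTerms), ([0, 1, 2, 3], qTerms)]) (n : ℕ) :
    classCount (n + 1) (fun i => l.getD i 0) =
      (terms.map fun a => a.1 * monomial (count n) a.2).sum := by
  have hk := List.all_eq_true.1 kronecker_copies _ h
  rw [Bool.and_eq_true] at hk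
  rw [classCount_succ, total_copies_eq l terms]
  · rw [Nat.eq_of_beq_eq_true hk.1, List.sum_eq_foldr, List.foldr_map]
    congr 1
    funext a r
    rw [← pow_mul]
    rfl
  · rw [List.sum_eq_foldr, List.foldr_map]
    exact Nat.le_of_ble_eq_true hk.2

/-- The recursion for `t`. -/
def tNext (t g h p _q : ℕ) : ℕ :=
  72 * t ^ 2 * p * (g + h) + 56 * t * (g + h) ^ 3 + 24 * t ^ 2 * p ^ 2 + 12 * t * p * (11 * g ^ 2 +
    12 * g * h + h ^ 2) + 12 * g ^ 2 * (3 * g ^ 2 + 8 * g * h + 6 * h ^ 2) + 12 * t * p ^ 2 * (4 *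
    g + h) + 48 * g ^ 2 * p * (g + h) + 4 * t * p ^ 3 + 12 * g ^ 2 * p ^ 2

theorem t_succ (n : ℕ) : t (n + 1) = tNext (t n) (g n) (h n) (p n) (q n) := by
  have hc : t (n + 1) = classCount (n + 1) fun i => [0, 0, 0, 0].getD i 0 :=
    classCount_congr (by decide)
  rw [hc, classCount_succ_eq_sum (terms := tTerms) (by simp)]
  simp only [tNext, tTerms, List.map_cons, List.map_nil, List.sum_cons, List.sum_nil, monomial,
    count, Nat.reduceMod, Nat.reduceDiv, Nat.reduceAdd, Nat.reduceSub, Matrix.cons_val]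
  ring

/-- The recursion for `g`. -/
def gNext (t g h p q : ℕ) : ℕ :=
  6 * t ^ 2 * q * (g + h) + 24 * t ^ 2 * p ^ 2 + 12 * t * p * (9 * g ^ 2 + 16 * g * h + 7 * h ^ 2)
    + 4 * g * (5 * g ^ 3 + 18 * g ^ 2 * h + 24 * g * h ^ 2 + 14 * h ^ 3) + 6 * t ^ 2 * p * q + 6 *
    t * p ^ 2 * (21 * g + 11 * h) + 3 * t * q * (5 * g ^ 2 + 6 * g * h + h ^ 2) + 24 * g * p * (5 *
    g ^ 2 + 9 * g * h + 4 * h ^ 2) + 6 * t * p * q * (3 * g + h) + 21 * t * p ^ 3 + 6 * g * p ^ 2 *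
    (19 * g + 13 * h) + 3 * g * q * (3 * g ^ 2 + 4 * g * h + h ^ 2) + 3 * t * p ^ 2 * q + 6 * g * p
    * q * (2 * g + h) + 25 * g * p ^ 3 + 3 * g * p ^ 2 * q

theorem g_succ (n : ℕ) : g (n + 1) = gNext (t n) (g n) (h n) (p n) (q n) := by
  have hc : g (n + 1) = classCount (n + 1) fun i => [0, 1, 1, 1].getD i 0 :=
    classCount_congr (by decide)
  rw [hc, classCount_succ_eq_sum (terms := gTerms) (by simp)]
  simp only [gNext, gTerms, List.map_cons, List.map_nil, List.sum_cons, List.sum_nil, monomial,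
    count, Nat.reduceMod, Nat.reduceDiv, Nat.reduceAdd, Nat.reduceSub, Matrix.cons_val]
  ring

/-- The recursion for `h`. -/
def hNext (t g h p _q : ℕ) : ℕ :=
  2 * t ^ 2 * p ^ 2 + 12 * t * p * (g ^ 2 + 4 * g * h + 3 * h ^ 2) + 2 * (g ^ 4 + 8 * g ^ 3 * h +
    18 * g ^ 2 * h ^ 2 + 16 * g * h ^ 3 + 11 * h ^ 4) + 8 * t * p ^ 2 * (2 * g + 3 * h) + 8 * p *
    (2 * g ^ 3 + 9 * g ^ 2 * h + 9 * g * h ^ 2 + 2 * h ^ 3) + 4 * t * p ^ 3 + 2 * p ^ 2 * (10 * g ^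
    2 + 24 * g * h + 9 * h ^ 2) + 8 * p ^ 3 * (g + h) + p ^ 4

theorem h_succ (n : ℕ) : h (n + 1) = hNext (t n) (g n) (h n) (p n) (q n) := by
  have hc : h (n + 1) = classCount (n + 1) fun i => [0, 0, 2, 2].getD i 0 :=
    classCount_congr (by decide)
  rw [hc, classCount_succ_eq_sum (terms := hTerms) (by simp)]
  simp only [hNext, hTerms, List.map_cons, List.map_nil, List.sum_cons, List.sum_nil, monomial,
    count, Nat.reduceMod, Nat.reduceDiv, Nat.reduceAdd, Nat.reduceSub, Matrix.cons_val]
  ring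

/-- The recursion for `p`. -/
def pNext (t g h p q : ℕ) : ℕ :=
  6 * t ^ 2 * p * q + 120 * t * p ^ 2 * (g + h) + 14 * t * q * (g + h) ^ 2 + 88 * p * (g + h) ^ 3 +
    4 * t * p * q * (13 * g + 10 * h) + 78 * t * p ^ 3 + 6 * p ^ 2 * (49 * g ^ 2 + 78 * g * h + 29
    * h ^ 2) + 2 * q * (11 * g ^ 3 + 26 * g ^ 2 * h + 19 * g * h ^ 2 + 4 * h ^ 3) + t ^ 2 * q ^ 2 +
    2 * t * q ^ 2 * (2 * g + h) + 26 * t * p ^ 2 * q + 2 * p * q * (38 * g ^ 2 + 50 * g * h + 15 *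
    h ^ 2) + 2 * p ^ 3 * (115 * g + 76 * h) + 2 * t * p * q ^ 2 + q ^ 2 * (4 * g ^ 2 + 4 * g * h +
    h ^ 2) + 2 * p ^ 2 * q * (31 * g + 18 * h) + 49 * p ^ 4 + 2 * p * q ^ 2 * (2 * g + h) + 14 * p
    ^ 3 * q + p ^ 2 * q ^ 2

theorem p_succ (n : ℕ) : p (n + 1) = pNext (t n) (g n) (h n) (p n) (q n) := by
  have hc : p (n + 1) = classCount (n + 1) fun i => [0, 0, 2, 3].getD i 0 :=
    classCount_congr (by decide)
  rw [hc, classCount_succ_eq_sum (terms := pTerms) (by simp)]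
  simp only [pNext, pTerms, List.map_cons, List.map_nil, List.sum_cons, List.sum_nil, monomial,
    count, Nat.reduceMod, Nat.reduceDiv, Nat.reduceAdd, Nat.reduceSub, Matrix.cons_val]
  ring

/-- The recursion for `q`. -/
def qNext (t g h p q : ℕ) : ℕ :=
  144 * t * p * q * (g + h) + 208 * t * p ^ 3 + 720 * p ^ 2 * (g + h) ^ 2 + 56 * q * (g + h) ^ 3 +
    24 * t * q ^ 2 * (g + h) + 252 * t * p ^ 2 * q + 24 * p * q * (25 * g ^ 2 + 44 * g * h + 19 * h
    ^ 2) + 104 * p ^ 3 * (17 * g + 15 * h) + 60 * t * p * q ^ 2 + 24 * q ^ 2 * (3 * g ^ 2 + 5 * g *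
    h + 2 * h ^ 2) + 12 * p ^ 2 * q * (110 * g + 89 * h) + 972 * p ^ 4 + 4 * t * q ^ 3 + 12 * p * q
    ^ 2 * (22 * g + 17 * h) + 776 * p ^ 3 * q + 4 * q ^ 3 * (4 * g + 3 * h) + 210 * p ^ 2 * q ^ 2 +
    24 * p * q ^ 3 + q ^ 4

theorem q_succ (n : ℕ) : q (n + 1) = qNext (t n) (g n) (h n) (p n) (q n) := by
  have hc : q (n + 1) = classCount (n + 1) fun i => [0, 1, 2, 3].getD i 0 :=
    classCount_congr (by decide)
  rw [hc, classCount_succ_eq_sum (terms := qTerms) (by simp)]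
  simp only [qNext, qTerms, List.map_cons, List.map_nil, List.sum_cons, List.sum_nil, monomial,
    count, Nat.reduceMod, Nat.reduceDiv, Nat.reduceAdd, Nat.reduceSub, Matrix.cons_val]
  ring

end SG3

namespace SG3

open SimpleGraph

/-! ### The number of vertices -/

theorem corner_injective (n : ℕ) : Function.Injective (corner n) := by
  intro i j h
  by_contra hij
  have := congrFun h i
  rw [corner_apply, corner_apply, if_pos rfl, if_neg (Ne.symm hij)] at this
  have : 0 < 2 ^ n := by positivity
  omega

/-- The vertices of the `i`-th copy of stage `n` in stage `n + 1`. -/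
def copyVerts (n : ℕ) (i : Fin 4) : Finset (Fin 4 → ℕ) :=
  (verts n).image fun x => x + corner n i

theorem card_copyVerts (n : ℕ) (i : Fin 4) : (copyVerts n i).card = (verts n).card :=
  Finset.card_image_of_injective _ (add_left_injective _)

theorem copyVerts_inter (n : ℕ) {i j : Fin 4} (hij : i ≠ j) :
    copyVerts n i ∩ copyVerts n j = {corner n j + corner n i} := by
  have hrange : ∀ i x, x ∈ copyVerts n i ↔ x ∈ Set.range (copyEmbedding n i) := by
    intro i x
    simp [copyVerts, copyEmbedding]
  ext x
  rw [Finset.mem_inter, Finset.mem_singleton, hrange, hrange]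
  constructor
  · exact fun h => eq_of_mem_range_copyEmbedding hij h.1 h.2
  · rintro rfl
    exact ⟨⟨outmost n j, rfl⟩, ⟨outmost n i, add_comm _ _⟩⟩

/-- Adding the copies in turn, copy `k` meets the union of the earlier ones in exactly `k` distinct
points, and `1 + 2 + 3 = 6`. -/
theorem card_verts_succ (n : ℕ) : (verts (n + 1)).card + 6 = 4 * (verts n).card := by
  have hunion : verts (n + 1) =
      copyVerts n 0 ∪ copyVerts n 1 ∪ copyVerts n 2 ∪ copyVerts n 3 := by
    ext x
    simp only [verts, copyVerts, Finset.mem_biUnion, Finset.mem_univ, true_and, Fin.exists_fin_succ,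
      Finset.mem_union, IsEmpty.exists_iff, or_false]
    simp only [or_assoc]
    rfl
  have hcard := card_copyVerts n
  have hne : ∀ {i j : Fin 4} (k : Fin 4), i ≠ j → corner n k + corner n i ≠ corner n k + corner n j :=
    fun k hij h => hij (corner_injective n (add_left_cancel h))
  have h01 := Finset.card_union_add_card_inter (copyVerts n 0) (copyVerts n 1)
  have h012 := Finset.card_union_add_card_inter (copyVerts n 0 ∪ copyVerts n 1) (copyVerts n 2)
  have h0123 := Finset.card_union_add_card_inter
    (copyVerts n 0 ∪ copyVerts n 1 ∪ copyVerts n 2) (copyVerts n 3)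
  rw [copyVerts_inter n (by decide), Finset.card_singleton] at h01
  rw [Finset.union_inter_distrib_right, copyVerts_inter n (by decide),
    copyVerts_inter n (by decide), Finset.singleton_union,
    Finset.card_pair (hne 2 (by decide))] at h012
  rw [Finset.union_inter_distrib_right, Finset.union_inter_distrib_right,
    copyVerts_inter n (by decide), copyVerts_inter n (by decide), copyVerts_inter n (by decide),
    Finset.singleton_union, Finset.insert_union, Finset.singleton_union,
    Finset.card_eq_three.2 ⟨_, _, _, hne 3 (by decide), hne 3 (by decide), hne 3 (by decide), rfl⟩]
    at h0123
  rw [hunion]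
  simp only [hcard] at h01 h012 h0123
  omega

theorem card_verts (n : ℕ) : (verts n).card = 2 * 4 ^ n + 2 := by
  induction n with
  | zero =>
    rw [verts, Finset.card_image_of_injective _ (corner_injective 0)]
    rfl
  | succ n ih =>
    have := card_verts_succ n
    rw [pow_succ]
    omega

/-! ### The counts at stage zero -/

/-- The edges between four points. -/
def tetrahedronEdges : List (ℕ × ℕ) := [(0, 1), (0, 2), (0, 3), (1, 2), (1, 3), (2, 3)]

/-- The list of those edges between four points which belong to `s`. -/
def edgeList (s : Finset (ℕ × ℕ)) : List (ℕ × ℕ) := tetrahedronEdges.filter (· ∈ s)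

/-- The corners at stage zero. -/
def vertex (a : ℕ) : Fin 4 → ℕ := corner 0 (Fin.ofNat 4 a)

theorem vertex_injOn : ∀ a < 4, ∀ b < 4, vertex a = vertex b → a = b := by
  intro a ha b hb h
  have := congrArg Fin.val (corner_injective 0 h)
  simpa [Nat.mod_eq_of_lt ha, Nat.mod_eq_of_lt hb] using this

theorem mem_verts_zero_iff {x : Fin 4 → ℕ} : x ∈ verts 0 ↔ ∃ a < 4, vertex a = x := by
  rw [mem_verts_zero]
  constructor
  · rintro ⟨i, rfl⟩
    exact ⟨i, i.2, by simp [vertex]⟩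
  · rintro ⟨a, -, rfl⟩
    exact ⟨_, rfl⟩

theorem tetrahedronEdges_spec :
    (∀ e ∈ tetrahedronEdges, e.1 < 4 ∧ e.2 < 4 ∧ e.1 ≠ e.2) ∧
    (tetrahedronEdges.Pairwise fun e e' => s(e.1, e.2) ≠ s(e'.1, e'.2)) ∧
    (∀ e ∈ tetrahedronEdges, ∀ e' ∈ tetrahedronEdges, s(e.1, e.2) = s(e'.1, e'.2) → e = e') ∧
    ∀ a < 4, ∀ b < 4, a ≠ b → (a, b) ∈ tetrahedronEdges ∨ (b, a) ∈ tetrahedronEdges :=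
  ⟨by decide, by decide +kernel, by decide +kernel,
    fun a ha b hb => by interval_cases a <;> interval_cases b <;> decide⟩

theorem edgeList_adj {s : Finset (ℕ × ℕ)} {e : ℕ × ℕ} (he : e ∈ tetrahedronEdges) :
    (listGraph vertex (edgeList s)).Adj (vertex e.1) (vertex e.2) ↔ e ∈ s := by
  obtain ⟨h1, -, h3, -⟩ := tetrahedronEdges_spec
  obtain ⟨ha, hb, hab⟩ := h1 e he
  rw [listGraph_adj_iff]
  constructor
  · rintro ⟨-, e', he', h⟩
    simp only [edgeList, List.mem_filter, decide_eq_true_eq] at he'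
    obtain ⟨ha', hb', -⟩ := h1 e' he'.1
    rw [h3 e he e' he'.1]
    · exact he'.2
    · rw [Sym2.eq_iff] at h ⊢
      exact h.imp (fun h => ⟨vertex_injOn _ ha _ ha' h.1, vertex_injOn _ hb _ hb' h.2⟩)
        (fun h => ⟨vertex_injOn _ ha _ hb' h.1, vertex_injOn _ hb _ ha' h.2⟩)
  · intro hs
    exact ⟨fun h => hab (vertex_injOn _ ha _ hb h), e, by simp [edgeList, he, hs], rfl⟩

theorem eq_listGraph_of_le {H : SimpleGraph (Fin 4 → ℕ)} (hH : H ≤ ambient 0) :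
    ∃ s ∈ tetrahedronEdges.toFinset.powerset, listGraph vertex (edgeList s) = H := by
  classical
  obtain ⟨h1, -, -, h4⟩ := tetrahedronEdges_spec
  refine ⟨tetrahedronEdges.toFinset.filter fun e => H.Adj (vertex e.1) (vertex e.2),
    by simp, ?_⟩
  ext x y
  constructor
  · intro h
    obtain ⟨e, he, h⟩ := listGraph_adj h
    simp only [edgeList, List.mem_filter, Finset.mem_filter, decide_eq_true_eq] at he
    rw [← mem_edgeSet, h]
    exact he.2.2
  · intro h
    obtain ⟨hne, hx, hy⟩ := ambient_zero_adj.1 (hH h)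
    obtain ⟨a, ha, rfl⟩ := mem_verts_zero_iff.1 hx
    obtain ⟨b, hb, rfl⟩ := mem_verts_zero_iff.1 hy
    rcases h4 a ha b hb (fun hab => hne (hab ▸ rfl)) with he | he
    · exact (edgeList_adj he).2 (by simpa using ⟨he, h⟩)
    · exact ((edgeList_adj he).2 (by simpa using ⟨he, h.symm⟩)).symm

theorem listGraph_le (s : Finset (ℕ × ℕ)) : listGraph vertex (edgeList s) ≤ ambient 0 := by
  intro x y h
  obtain ⟨e, he, h'⟩ := listGraph_adj h
  rw [ambient_zero_adj]
  refine ⟨h.ne, ?_⟩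
  have he' := tetrahedronEdges_spec.1 e (List.mem_of_mem_filter he)
  rw [Sym2.eq_iff] at h'
  rcases h' with ⟨rfl, rfl⟩ | ⟨rfl, rfl⟩
  · exact ⟨mem_verts_zero_iff.2 ⟨_, he'.1, rfl⟩, mem_verts_zero_iff.2 ⟨_, he'.2.1, rfl⟩⟩
  · exact ⟨mem_verts_zero_iff.2 ⟨_, he'.2.1, rfl⟩, mem_verts_zero_iff.2 ⟨_, he'.1, rfl⟩⟩

/-- Subgraphs of the tetrahedron correspond to the `64` subsets of its six edges, and `joinAll`
decides for each whether it is a forest and which partition it induces. -/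
theorem classCount_zero (l : List ℕ) : classCount 0 (fun i => l.getD i 0) =
    (tetrahedronEdges.toFinset.powerset.filter fun s =>
      joinAll (edgeList s) 12816 ≠ 0 ∧
        matchesPattern l (joinAll (edgeList s) 12816 - 1) = true).card := by
  obtain ⟨h1, h2, -, -⟩ := tetrahedronEdges_spec
  rw [classCount_eq_ncard (Function.Embedding.subtype (· ∈ verts 0)), gasket_map_subtype,
    ← Set.ncard_coe_finset]
  have hspec : ∀ s : Finset (ℕ × ℕ),
      ((listGraph vertex (edgeList s)).IsAcyclic ∧ ∀ i j : Fin 4,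
        ((listGraph vertex (edgeList s)).Reachable (corner 0 i) (corner 0 j) ↔
          l.getD i 0 = l.getD j 0)) ↔ joinAll (edgeList s) 12816 ≠ 0 ∧
        matchesPattern l (joinAll (edgeList s) 12816 - 1) = true := by
    intro s
    have hmem : ∀ e ∈ edgeList s, e ∈ tetrahedronEdges := fun e he => List.mem_of_mem_filter he
    obtain ⟨h5, h6⟩ := joinAll_spec (m := 4) (by norm_num) (edgeList s) ⊥ 12816 isAcyclic_bot
      (represents_bot (by decide) vertex_injOn)
      (fun e he => ⟨(h1 e (hmem e he)).1, (h1 e (hmem e he)).2.1, fun h => (h1 e (hmem e he)).2.2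
        (vertex_injOn _ (h1 e (hmem e he)).1 _ (h1 e (hmem e he)).2.1 h), by simp⟩)
      (pairwise_edge_ne vertex_injOn
        (fun e he => ⟨(h1 e (hmem e he)).1, (h1 e (hmem e he)).2.1⟩)
        (h2.sublist List.filter_sublist))
    rw [bot_sup_eq] at h5 h6
    rw [h5]
    refine and_congr_right fun hne => ?_
    have h7 := h6 (joinAll (edgeList s) 12816 - 1) (by omega)
    rw [matchesPattern_iff]
    have hv : ∀ i : Fin 4, corner 0 i = vertex i := fun i => by simp [vertex]
    simp only [hv]
    constructor
    · intro h a ha b hb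
      rw [← h7 a ha b hb]
      exact h ⟨a, ha⟩ ⟨b, hb⟩
    · intro h i j
      rw [h7 i i.2 j j.2]
      exact h i i.2 j j.2
  have himage : {H | H ≤ ambient 0 ∧ H.IsAcyclic ∧ ∀ i j : Fin 4,
      (H.Reachable (corner 0 i) (corner 0 j) ↔ l.getD i 0 = l.getD j 0)} =
      (fun s => listGraph vertex (edgeList s)) '' (tetrahedronEdges.toFinset.powerset.filter
        fun s => joinAll (edgeList s) 12816 ≠ 0 ∧
          matchesPattern l (joinAll (edgeList s) 12816 - 1) = true : Finset _) := by
    ext H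
    constructor
    · rintro ⟨hH, h⟩
      obtain ⟨s, hs, rfl⟩ := eq_listGraph_of_le hH
      exact ⟨s, by simpa only [Finset.coe_filter, Set.mem_ofPred_eq] using ⟨hs, (hspec s).1 h⟩, rfl⟩
    · rintro ⟨s, hs, rfl⟩
      simp only [Finset.coe_filter, Set.mem_ofPred_eq] at hs
      exact ⟨listGraph_le s, (hspec s).2 hs.2⟩
  refine (congrArg Set.ncard himage).trans (Set.InjOn.ncard_image ?_)
  intro s hs s' hs' h
  simp only [Finset.coe_filter, Set.mem_ofPred_eq, Finset.mem_powerset] at hs hs'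
  ext e
  by_cases he : e ∈ tetrahedronEdges
  · rw [← edgeList_adj he, ← edgeList_adj he]
    exact iff_of_eq (congrArg (fun H : SimpleGraph (Fin 4 → ℕ) => H.Adj _ _) h)
  · exact ⟨fun h => absurd (by simpa using hs.1 h) he, fun h => absurd (by simpa using hs'.1 h) he⟩

theorem t_zero : t 0 = 16 := by
  have hc : t 0 = classCount 0 fun i => [0, 0, 0, 0].getD i 0 :=
    classCount_congr (by decide)
  rw [hc, classCount_zero]
  decide +kernel

theorem g_zero : g 0 = 3 := by
  have hc : g 0 = classCount 0 fun i => [0, 1, 1, 1].getD i 0 :=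
    classCount_congr (by decide)
  rw [hc, classCount_zero]
  decide +kernel

theorem h_zero : h 0 = 1 := by
  have hc : h 0 = classCount 0 fun i => [0, 0, 2, 2].getD i 0 :=
    classCount_congr (by decide)
  rw [hc, classCount_zero]
  decide +kernel

theorem p_zero : p 0 = 1 := by
  have hc : p 0 = classCount 0 fun i => [0, 0, 2, 3].getD i 0 :=
    classCount_congr (by decide)
  rw [hc, classCount_zero]
  decide +kernel

theorem q_zero : q 0 = 1 := by
  have hc : q 0 = classCount 0 fun i => [0, 1, 2, 3].getD i 0 :=
    classCount_congr (by decide)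
  rw [hc, classCount_zero]
  decide +kernel

end SG3

namespace SG3

/-! ### Growth -/

theorem p_pos (n : ℕ) : 0 < p n := by
  induction n with
  | zero => rw [p_zero]; norm_num
  | succ n ih =>
    rw [p_succ, pNext]
    positivity

theorem q_pos (n : ℕ) : 0 < q n := by
  induction n with
  | zero => rw [q_zero]; norm_num
  | succ n ih =>
    rw [q_succ, qNext]
    positivity

/-- `q n ^ 4` is one term of the recursion; the others are nonnegative, and the one in `p n ^ 4` is
positive. -/
theorem q_pow_lt (n : ℕ) : q n ^ 4 < q (n + 1) := by
  have := p_pos n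
  rw [q_succ, qNext]
  exact lt_add_of_pos_left _ (by positivity)

theorem q_le_f (n : ℕ) : q n ≤ f n := by
  rw [f_eq]
  exact Nat.le_add_left _ _

/-- Here `t + 2g + h + p` counts forests joining two given outmost vertices, and `t + g` those
joining three. The formula is inclusion and exclusion over cycles running round three copies (four
ways) or all four (three ways), but follows from the other recursions by expansion. -/
theorem f_succ (n : ℕ) : (f (n + 1) : ℤ) =
    (f n : ℤ) ^ 4 - 4 * f n * (t n + 2 * g n + h n + p n : ℤ) ^ 3 -
      3 * (t n + 2 * g n + h n + p n : ℤ) ^ 4 +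
      12 * (t n + 2 * g n + h n + p n : ℤ) ^ 2 * (t n + g n : ℤ) ^ 2 -
      6 * (t n + g n : ℤ) ^ 4 := by
  rw [f_eq, f_eq, t_succ, g_succ, h_succ, p_succ, q_succ, tNext, gNext, hNext, pNext, qNext]
  push_cast
  ring

theorem f_lt_pow (n : ℕ) : f (n + 1) < f n ^ 4 := by
  zify
  rw [f_succ]
  set R : ℤ := t n + 2 * g n + h n + p n with hR
  set A : ℤ := t n + g n
  have hRpos : 0 < R := by
    have := p_pos n
    positivity
  have hRf : R ≤ f n := by
    rw [f_eq, hR]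
    push_cast
    have : (0 : ℤ) ≤ g n := by positivity
    have : (0 : ℤ) ≤ h n := by positivity
    have : (0 : ℤ) ≤ p n := by positivity
    have : (0 : ℤ) ≤ q n := by positivity
    linarith
  have h1 := mul_nonneg (sub_nonneg.2 hRf) (pow_pos hRpos 3).le
  have h2 := pow_pos hRpos 4
  -- As `f n ≥ R`, the amount subtracted from `f n ^ 4` is at least `7 R⁴ - 12 R² A² + 6 A⁴ = R⁴ + 6
  -- (R² - A²)²`, which is positive.
  nlinarith [sq_nonneg (R ^ 2 - A ^ 2)]

/-- The upper approximations to the growth constant. -/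
noncomputable def upper (n : ℕ) : ℝ := Real.log (f n) / (2 * 4 ^ n)

/-- The lower approximations to the growth constant. -/
noncomputable def lower (n : ℕ) : ℝ := Real.log (q n) / (2 * 4 ^ n)

theorem strictAnti_upper : StrictAnti upper := by
  refine strictAnti_nat_of_succ_lt fun n => ?_
  rw [upper, upper, pow_succ, div_lt_div_iff₀ (by positivity) (by positivity)]
  have hpos : (0 : ℝ) < f (n + 1) := by exact_mod_cast (q_pos _).trans_le (q_le_f _)
  have hlt : (f (n + 1) : ℝ) < (f n : ℝ) ^ 4 := by exact_mod_cast f_lt_pow n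
  have := Real.log_lt_log hpos hlt
  rw [Real.log_pow] at this
  push_cast at this
  nlinarith [pow_pos (show (0 : ℝ) < 4 by norm_num) n]

theorem strictMono_lower : StrictMono lower := by
  refine strictMono_nat_of_lt_succ fun n => ?_
  rw [lower, lower, pow_succ, div_lt_div_iff₀ (by positivity) (by positivity)]
  have hpos : (0 : ℝ) < (q n : ℝ) ^ 4 := by
    have := q_pos n
    positivity
  have hlt : (q n : ℝ) ^ 4 < q (n + 1) := by exact_mod_cast q_pow_lt n
  have := Real.log_lt_log hpos hlt
  rw [Real.log_pow] at this
  push_cast at this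
  nlinarith [pow_pos (show (0 : ℝ) < 4 by norm_num) n]

theorem lower_le_upper (m n : ℕ) : lower m ≤ upper n := by
  calc lower m ≤ lower (max m n) := strictMono_lower.monotone (le_max_left _ _)
    _ ≤ upper (max m n) := by
      rw [lower, upper]
      have hpos : (0 : ℝ) < q (max m n) := by exact_mod_cast q_pos _
      have hle : (q (max m n) : ℝ) ≤ f (max m n) := by exact_mod_cast q_le_f _
      gcongr
    _ ≤ upper n := strictAnti_upper.antitone (le_max_right _ _)

/-- The growth constant. -/
noncomputable def growth : ℝ := ⨅ n, upper n

theorem bddBelow_upper : BddBelow (Set.range upper) :=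
  ⟨lower 0, by rintro _ ⟨n, rfl⟩; exact lower_le_upper 0 n⟩

theorem growth_lt_upper (m : ℕ) : growth < upper m :=
  (ciInf_le bddBelow_upper (m + 1)).trans_lt (strictAnti_upper (Nat.lt_succ_self m))

theorem lower_lt_growth (m : ℕ) : lower m < growth :=
  (strictMono_lower (Nat.lt_succ_self m)).trans_le (le_ciInf fun n => lower_le_upper (m + 1) n)

theorem tendsto_log_f_div_card :
    Tendsto (fun n : ℕ => Real.log (f n) / ((verts n).card : ℝ)) atTop (𝓝 growth) := by
  have h1 : Tendsto upper atTop (𝓝 growth) :=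
    tendsto_atTop_ciInf strictAnti_upper.antitone bddBelow_upper
  -- This is the ratio of `2 * 4 ^ n` to the number `2 * 4 ^ n + 2` of vertices.
  have h2 : Tendsto (fun n : ℕ => 1 / (1 + (1 / 4 : ℝ) ^ n)) atTop (𝓝 (1 / (1 + 0))) :=
    tendsto_const_nhds.div (tendsto_const_nhds.add
      (tendsto_pow_atTop_nhds_zero_of_lt_one (by norm_num) (by norm_num))) (by norm_num)
  have h3 := h1.mul h2
  rw [add_zero, div_one, mul_one] at h3
  refine h3.congr fun n => ?_
  rw [upper, card_verts, one_div_pow]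
  push_cast
  field_simp

/-! ### Numerical bounds -/

/-- `F x`, with `x` evaluated first. -/
def force {α : Type*} (x : ℕ) (F : ℕ → α) : α :=
  match x with
  | 0 => F 0
  | k + 1 => F (Nat.succ k)

theorem force_eq {α : Type*} (x : ℕ) (F : ℕ → α) : force x F = F x := by
  cases x <;> rfl

/-- The values of `F` after iterating the recursion. -/
def iterate (F : ℕ → ℕ → ℕ → ℕ → ℕ → Bool) : ℕ → ℕ → ℕ → ℕ → ℕ → ℕ → Bool
  | 0, t, g, h, p, q => F t g h p q
  | m + 1, t, g, h, p, q =>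
    force (tNext t g h p q) fun t' => force (gNext t g h p q) fun g' =>
      force (hNext t g h p q) fun h' => force (pNext t g h p q) fun p' =>
        force (qNext t g h p q) fun q' => iterate F m t' g' h' p' q'

theorem iterate_eq (F : ℕ → ℕ → ℕ → ℕ → ℕ → Bool) (m n : ℕ) :
    iterate F m (t n) (g n) (h n) (p n) (q n) =
      F (t (n + m)) (g (n + m)) (h (n + m)) (p (n + m)) (q (n + m)) := by
  induction m generalizing n with
  | zero => rfl
  | succ m ih =>
    simp only [iterate, force_eq]
    rw [← t_succ, ← g_succ, ← h_succ, ← p_succ, ← q_succ, ih (n + 1), add_right_comm, add_assoc]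

theorem iterate_zero_eq (F : ℕ → ℕ → ℕ → ℕ → ℕ → Bool) (m : ℕ) :
    iterate F m 16 3 1 1 1 = F (t m) (g m) (h m) (p m) (q m) := by
  have := iterate_eq F m 0
  rwa [t_zero, g_zero, h_zero, p_zero, q_zero, zero_add] at this

theorem pow_le_q_mul (a b k m : ℕ) (hab : iterate (fun _ _ _ _ q =>
    Nat.ble (Nat.pow a k) (Nat.mul q (Nat.pow b k))) m 16 3 1 1 1 = true) :
    a ^ k ≤ q m * b ^ k := by
  rw [iterate_zero_eq] at hab
  exact Nat.le_of_ble_eq_true hab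

theorem f_mul_le_pow (a b k m : ℕ) (hab : iterate (fun t g h p q =>
    Nat.ble (Nat.mul (t + 4 * g + 3 * h + 6 * p + q) (Nat.pow b k)) (Nat.pow a k)) m 16 3 1 1 1 =
      true) : f m * b ^ k ≤ a ^ k := by
  rw [iterate_zero_eq] at hab
  rw [f_eq]
  exact Nat.le_of_ble_eq_true hab

/-- The exponent is `2 * 4 ^ 7`, and the base over `10 ^ 14` is a rational number between `exp
1.66680628117` and the corresponding root of `q 7`. For the upper bound stage `5`, with exponent `2
* 4 ^ 5`, already suffices. -/
theorem le_q_seven : 529522928967189 ^ 32768 ≤ q 7 * (10 ^ 14) ^ 32768 :=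
  pow_le_q_mul 529522928967189 (10 ^ 14) 32768 7 (by decide +kernel)

theorem f_five_le : f 5 * (10 ^ 14) ^ 2048 ≤ 529522928972483 ^ 2048 :=
  f_mul_le_pow 529522928972483 (10 ^ 14) 2048 5 (by decide +kernel)

theorem exp_le : Real.exp 1.66680628117 ≤ 529522928967189 / 10 ^ 14 := by
  -- The argument is halved because the Taylor bound requires it to be at most one; the result is
  -- squared afterwards.
  have h := Real.exp_bound' (x := 0.833403140585) (by norm_num) (by norm_num)
    (show 0 < 18 by norm_num)
  have h' : Real.exp 0.833403140585 ≤ 2.301136521302438 := by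
    refine h.trans ?_
    norm_num [Finset.sum_range_succ, Nat.factorial]
  rw [show (1.66680628117 : ℝ) = (2 : ℕ) * 0.833403140585 by norm_num, Real.exp_nat_mul]
  refine (pow_le_pow_left₀ (Real.exp_pos _).le h' 2).trans ?_
  norm_num

theorem le_exp : 529522928972483 / 10 ^ 14 ≤ Real.exp 1.66680628118 := by
  have h := Real.sum_le_exp_of_nonneg (x := 0.83340314059) (by norm_num) 18
  have h' : 2.301136521313943 ≤ Real.exp 0.83340314059 := by
    refine le_trans ?_ h
    norm_num [Finset.sum_range_succ, Nat.factorial]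
  rw [show (1.66680628118 : ℝ) = (2 : ℕ) * 0.83340314059 by norm_num, Real.exp_nat_mul]
  refine le_trans ?_ (pow_le_pow_left₀ (by norm_num) h' 2)
  norm_num

theorem le_lower_seven : 1.66680628117 ≤ lower 7 := by
  rw [lower, le_div_iff₀ (by positivity), Real.le_log_iff_exp_le (by exact_mod_cast q_pos 7),
    show (1.66680628117 : ℝ) * (2 * 4 ^ 7) = (32768 : ℕ) * 1.66680628117 by norm_num,
    Real.exp_nat_mul]
  refine (pow_le_pow_left₀ (Real.exp_pos _).le exp_le _).trans ?_
  rw [div_pow, div_le_iff₀ (by positivity)]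
  exact_mod_cast le_q_seven

theorem upper_five_le : upper 5 ≤ 1.66680628118 := by
  have hpos : (0 : ℝ) < f 5 := by exact_mod_cast (q_pos _).trans_le (q_le_f _)
  rw [upper, div_le_iff₀ (by positivity), Real.log_le_iff_le_exp hpos,
    show (1.66680628118 : ℝ) * (2 * 4 ^ 5) = (2048 : ℕ) * 1.66680628118 by norm_num,
    Real.exp_nat_mul]
  refine le_trans ?_ (pow_le_pow_left₀ (by positivity) le_exp _)
  rw [div_pow, le_div_iff₀ (by positivity)]
  exact_mod_cast f_five_le

end SG3

theorem proposition4 :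
    -- the class counts do not depend on which outmost vertices are chosen
    (∀ (n : ℕ) (c : Fin 4 → ℕ) (σ : Equiv.Perm (Fin 4)),
      SG3.classCount n (c ∘ σ) = SG3.classCount n c) ∧
    -- recursion relations
    (∀ (n : ℕ) (f t g h p q : ℤ), f = SG3.f n → t = SG3.t n → g = SG3.g n →
      h = SG3.h n → p = SG3.p n → q = SG3.q n →
      (SG3.f (n + 1) : ℤ) =
        f ^ 4 - 4 * f * (t + 2 * g + h + p) ^ 3 - 3 * (t + 2 * g + h + p) ^ 4 +
        12 * (t + 2 * g + h + p) ^ 2 * (t + g) ^ 2 - 6 * (t + g) ^ 4 ∧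
      (SG3.t (n + 1) : ℤ) =
        72 * t ^ 2 * p * (g + h) + 56 * t * (g + h) ^ 3 + 24 * t ^ 2 * p ^ 2 +
        12 * t * p * (11 * g ^ 2 + 12 * g * h + h ^ 2) +
        12 * g ^ 2 * (3 * g ^ 2 + 8 * g * h + 6 * h ^ 2) + 12 * t * p ^ 2 * (4 * g + h) +
        48 * g ^ 2 * p * (g + h) + 4 * t * p ^ 3 + 12 * g ^ 2 * p ^ 2 ∧
      (SG3.g (n + 1) : ℤ) =
        6 * t ^ 2 * q * (g + h) + 24 * t ^ 2 * p ^ 2 +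
        12 * t * p * (9 * g ^ 2 + 16 * g * h + 7 * h ^ 2) +
        4 * g * (5 * g ^ 3 + 18 * g ^ 2 * h + 24 * g * h ^ 2 + 14 * h ^ 3) +
        6 * t ^ 2 * p * q + 6 * t * p ^ 2 * (21 * g + 11 * h) +
        3 * t * q * (5 * g ^ 2 + 6 * g * h + h ^ 2) +
        24 * g * p * (5 * g ^ 2 + 9 * g * h + 4 * h ^ 2) + 6 * t * p * q * (3 * g + h) +
        21 * t * p ^ 3 + 6 * g * p ^ 2 * (19 * g + 13 * h) +
        3 * g * q * (3 * g ^ 2 + 4 * g * h + h ^ 2) + 3 * t * p ^ 2 * q +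
        6 * g * p * q * (2 * g + h) + 25 * g * p ^ 3 + 3 * g * p ^ 2 * q ∧
      (SG3.h (n + 1) : ℤ) =
        2 * t ^ 2 * p ^ 2 + 12 * t * p * (g ^ 2 + 4 * g * h + 3 * h ^ 2) +
        2 * (g ^ 4 + 8 * g ^ 3 * h + 18 * g ^ 2 * h ^ 2 + 16 * g * h ^ 3 + 11 * h ^ 4) +
        8 * t * p ^ 2 * (2 * g + 3 * h) +
        8 * p * (2 * g ^ 3 + 9 * g ^ 2 * h + 9 * g * h ^ 2 + 2 * h ^ 3) + 4 * t * p ^ 3 +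
        2 * p ^ 2 * (10 * g ^ 2 + 24 * g * h + 9 * h ^ 2) + 8 * p ^ 3 * (g + h) + p ^ 4 ∧
      (SG3.p (n + 1) : ℤ) =
        6 * t ^ 2 * p * q + 120 * t * p ^ 2 * (g + h) + 14 * t * q * (g + h) ^ 2 +
        88 * p * (g + h) ^ 3 + 4 * t * p * q * (13 * g + 10 * h) + 78 * t * p ^ 3 +
        6 * p ^ 2 * (49 * g ^ 2 + 78 * g * h + 29 * h ^ 2) +
        2 * q * (11 * g ^ 3 + 26 * g ^ 2 * h + 19 * g * h ^ 2 + 4 * h ^ 3) +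
        t ^ 2 * q ^ 2 + 2 * t * q ^ 2 * (2 * g + h) + 26 * t * p ^ 2 * q +
        2 * p * q * (38 * g ^ 2 + 50 * g * h + 15 * h ^ 2) +
        2 * p ^ 3 * (115 * g + 76 * h) + 2 * t * p * q ^ 2 +
        q ^ 2 * (4 * g ^ 2 + 4 * g * h + h ^ 2) + 2 * p ^ 2 * q * (31 * g + 18 * h) +
        49 * p ^ 4 + 2 * p * q ^ 2 * (2 * g + h) + 14 * p ^ 3 * q + p ^ 2 * q ^ 2 ∧
      (SG3.q (n + 1) : ℤ) =
        144 * t * p * q * (g + h) + 208 * t * p ^ 3 + 720 * p ^ 2 * (g + h) ^ 2 +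
        56 * q * (g + h) ^ 3 + 24 * t * q ^ 2 * (g + h) + 252 * t * p ^ 2 * q +
        24 * p * q * (25 * g ^ 2 + 44 * g * h + 19 * h ^ 2) +
        104 * p ^ 3 * (17 * g + 15 * h) + 60 * t * p * q ^ 2 +
        24 * q ^ 2 * (3 * g ^ 2 + 5 * g * h + 2 * h ^ 2) +
        12 * p ^ 2 * q * (110 * g + 89 * h) + 972 * p ^ 4 + 4 * t * q ^ 3 +
        12 * p * q ^ 2 * (22 * g + 17 * h) + 776 * p ^ 3 * q +
        4 * q ^ 3 * (4 * g + 3 * h) + 210 * p ^ 2 * q ^ 2 + 24 * p * q ^ 3 + q ^ 4) ∧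
    -- growth constant, its decimal expansion, and the bounds
    (∃ z : ℝ,
      Tendsto (fun n : ℕ => Real.log (numSpanningForests (SG3.gasket n)) /
        ((SG3.verts n).card : ℝ)) atTop (𝓝 z) ∧
      1.66680628117 ≤ z ∧ z < 1.66680628118 ∧
      ∀ m : ℕ,
        Real.log (SG3.q m) / (2 * 4 ^ m) < z ∧ z < Real.log (SG3.f m) / (2 * 4 ^ m)) := by
  refine ⟨SG3.classCount_comp_perm, ?_, SG3.growth, SG3.tendsto_log_f_div_card,
    SG3.le_lower_seven.trans (SG3.lower_lt_growth 7).le,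
    (SG3.growth_lt_upper 5).trans_le SG3.upper_five_le,
    fun m => ⟨SG3.lower_lt_growth m, SG3.growth_lt_upper m⟩⟩
  rintro n _ _ _ _ _ _ rfl rfl rfl rfl rfl rfl
  refine ⟨SG3.f_succ n, ?_, ?_, ?_, ?_, ?_⟩
  · rw [SG3.t_succ, SG3.tNext]
    push_cast
    rfl
  · rw [SG3.g_succ, SG3.gNext]
    push_cast
    rfl
  · rw [SG3.h_succ, SG3.hNext]
    push_cast
    rfl
  · rw [SG3.p_succ, SG3.pNext]
    push_cast
    rfl
  · rw [SG3.q_succ, SG3.qNext]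
    push_cast
    rfl
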